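/- **Setting.** A probabilistic social network is a directed graph $G=(V,E)$, $n=|V|\ge 2$, $m=|E|$, with a propagation probability $p(e)\in(0,1]$ on every edge. In a random realization $\Phi$ (independent cascade model) every edge $e$ is live independently with probability $p(e)$; a seed set activates the nodes reachable from it along live edges. Given integers $1\le b\le\eta\le n$ and $\varepsilon\in(0,1)$, ASTI proceeds in rounds until at least $\eta$ nodes are active. In round $i$ let $V_i$ be the set of inactive nodes, $G_i$ the subgraph induced by $V_i$, with $n_i$ nodes and $m_i$ edges, and $\eta_i=\eta-(n-n_i)$. ASTI calls TRIM-B on $G_i$ with batch size $b_i=\min\{b,n_i\}$, observes the nodes that the returned batch activates in $G_i$, and removes them. A random mRR-set of $G_i$ is the set of nodes that can reach, in a random realization of $G_i$, a uniformly random set of $k$ nodes, where $k=\lfloor n_i/\eta_i\rfloor+1$ with probability $n_i/\eta_i-\lfloor n_i/\eta_i\rfloor$ and $k=\lfloor n_i/\eta_i\rfloor$ otherwise; it is generated by a stochastic reverse breadth first search. With $\delta=\frac{\varepsilon}{100(1-1/e)(1-\varepsilon)\eta_i}$, $\hat\varepsilon=\frac{99\varepsilon}{100-\varepsilon}$, $\rho=1-(1-1/b_i)^{b_i}$,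 $$\theta_{\max}=\frac{2n_i\Big(\sqrt{\ln\frac6\delta}+\sqrt{\big(\ln\binom{n_i}{b_i}+\ln\frac6\delta\big)/\rho}\Big)^2}{b_i\hat\varepsilon^2},\qquad \theta_\circ=\frac{\theta_{\max}b_i\hat\varepsilon^2}{n_i},\qquad T=\Big\lceil\log_2\frac{\theta_{\max}}{\theta_\circ}\Big\rceil+1,$$ $a_1=\ln\frac{3T}\delta+\ln\binom{n_i}{b_i}$ and $a_2=\ln\frac{3T}\delta$ (with $\sqrt{x}=0$ for $x<0$ and $x/0=0$, $\log_2 0=0$, which matters only for $\varepsilon$ very close to $1$), TRIM-B generates a list $\mathcal R$ of $\lceil\theta_\circ\rceil$ independent mRR-sets and, in each of at most $T$ iterations, finds a set $S$ of $b_i$ nodes by the greedy algorithm for maximum coverage of $\mathcal R$, and computes the number $\Lambda$ of sets in $\mathcal R$ that $S$ intersects. It returns $S$ in the $T$-th iteration, or if $$\frac{\big(\sqrt{\Lambda+2a_1/9}-\sqrt{a_1/2}\big)^2-a_1/18}{\big(\sqrt{\Lambda/\rho+a_2/2}+\sqrt{a_2/2}\big)^2}\ \ge\ \rho(1-\hat\varepsilon);$$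 otherwise it doubles the size of $\mathcal R$ by generating new mRR-sets. Time is the number of elementary steps on a RAM with real arithmetic and unit-cost random draws, including the observation of the influence and the update of the residual graph. **Theorem.** For every $c\in\mathbb N$ there is a constant $C>0$ such that for all $G,\eta,b,\varepsilon$ as above with $\varepsilon\ge n^{-c}$: 1. the expected running time of ASTI instantiated with TRIM-B, over the random realization and the random choices of the algorithm, is at most $C\,\frac{\eta\,(m+n)}{\varepsilon^2}\ln n$; the same bound holds for every fixed realization, in expectation over the random choices of the algorithm alone; 2. for every possible set $V_i$ of inactive nodes at the beginning of a round (any $V_i\subseteq V$ with $\eta_i\ge1$) such that $n_i\ge 2$ and $\varepsilon\ge n_i^{-c}$, the expected running time of the round is at most $C\,\frac{b\,(m_i+n_i)\ln n_i}{\varepsilon^2}$; 3. in every run, at least $\eta$ nodes are active after at most $\lceil\eta/b\rceil=O(\eta/b)$ rounds. -/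

import Mathlib

open scoped ENNReal

/-!
Adaptive seed minimization under the independent cascade model: the algorithm ASTI instantiated
with TRIM-B, written as a randomized program in which every elementary operation of a (real) RAM
is counted.
-/

namespace ASM

/-! ### Randomized computations with a step counter -/

/-- A randomized computation of a value of type `α`: the joint law of the value returned and of
the number of elementary steps performed. -/
def RandCost (α : Type) : Type := PMF (α × ℕ)

namespace RandCost

/-- Sequential composition: run `x`, feed its value to `f`, and add up the steps. -/
noncomputable def bind {α β : Type} (x : RandCost α) (f : α → RandCost β) : RandCost β :=
  PMF.bind x fun a => PMF.map (fun r : β × ℕ => (r.1, a.2 + r.2)) (f a.1)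

noncomputable instance : Monad RandCost where
  pure a := PMF.pure (a, 0)
  bind := bind

/-- The set of the pairs (value, number of steps) that occur with positive probability. -/
def outcomes {α : Type} (x : RandCost α) : Set (α × ℕ) := PMF.support x

/-- The expected number of steps. -/
noncomputable def expectedCost {α : Type} (x : RandCost α) : ℝ≥0∞ :=
  ∑' r : α × ℕ, (show PMF (α × ℕ) from x) r * (r.2 : ℝ≥0∞)

end RandCost

/-- Perform `k` elementary steps. -/
noncomputable def tick (k : ℕ) : RandCost Unit := PMF.pure ((), k)

/-- Draw from the law `p`, in one step. -/
noncomputable def sample {α : Type} (p : PMF α) : RandCost α := PMF.map (fun a => (a, 1)) p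

/-- Flip, in one step, a coin with head probability `q` (for `0 ≤ q ≤ 1`). -/
noncomputable def coin (q : ℝ) : RandCost Bool :=
  sample (PMF.bernoulli (min q.toNNReal 1) (min_le_right _ _))

/-! ### Probabilistic social networks and realizations -/

/-- A probabilistic social network: a directed graph on the node set `V` with a propagation
probability in `(0, 1]` on every edge. -/
structure ProbGraph (V : Type) where
  edges : Finset (V × V)
  prob : V × V → ℝ
  prob_pos : ∀ e ∈ edges, 0 < prob e
  prob_le_one : ∀ e ∈ edges, prob e ≤ 1

variable {V : Type} [Fintype V] [DecidableEq V]

/-- The number of edges of the subgraph induced by `Vi`. -/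
def ProbGraph.edgeCount (G : ProbGraph V) (Vi : Finset V) : ℕ :=
  (G.edges.filter fun e => e.1 ∈ Vi ∧ e.2 ∈ Vi).card

/-- The list of the incoming neighbours of `v` in the subgraph induced by `Vi`. -/
noncomputable def ProbGraph.inNeighbors (G : ProbGraph V) (Vi : Finset V) (v : V) : List V :=
  (Vi.filter fun u => (u, v) ∈ G.edges).toList

/-- The probability of the realization whose set of live edges is `φ ⊆ G.edges`: every edge is
live independently with its propagation probability. -/
noncomputable def ProbGraph.realizationProb (G : ProbGraph V) (φ : Finset (V × V)) : ℝ :=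
  (∏ e ∈ φ, G.prob e) * ∏ e ∈ G.edges \ φ, (1 - G.prob e)

open Classical in
/-- The nodes that the seed set `S` activates in the subgraph induced by `Vi`, when `φ` is the set
of live edges: the nodes reachable from `S` along live edges inside `Vi`. -/
noncomputable def influenced (Vi : Finset V) (φ : Finset (V × V)) (S : Finset V) : Finset V :=
  Vi.filter fun v => ∃ s ∈ S, s ∈ Vi ∧
    Relation.ReflTransGen (fun u w => u ∈ Vi ∧ w ∈ Vi ∧ (u, w) ∈ φ) s v

/-! ### Random multi-root reverse reachable (mRR) sets -/

/-- Add to `K` one after the other `k` nodes of `Vi`, each drawn uniformly at random among the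
nodes of `Vi` not chosen yet. A draw is one step (swap the node drawn out of an array). -/
noncomputable def drawNodes (Vi : Finset V) : ℕ → Finset V → RandCost (Finset V)
  | 0, K => pure K
  | k + 1, K =>
    if h : (Vi \ K).Nonempty then do
      let v ← sample (PMF.uniformOfFinset (Vi \ K) h)
      drawNodes Vi k (insert v K)
    else pure K

/-- Stochastic reverse breadth first search in the subgraph induced by `Vi`, with a queue and the
set `R` of the nodes visited so far. A node is processed by examining all its incoming edges; each
is live with its propagation probability, and the tails of live edges that have not been visited
are visited and enqueued. The first argument bounds the number of nodes that are processed; as no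
node is enqueued twice, the bound `Vi.card` never cuts a search short. -/
noncomputable def reverseBFS (G : ProbGraph V) (Vi : Finset V) :
    ℕ → List V → Finset V → RandCost (Finset V)
  | 0, _, R => pure R
  | _ + 1, [], R => pure R
  | fuel + 1, v :: queue, R => do
    tick 1
    let st ← (G.inNeighbors Vi v).foldlM
      (fun (st : List V × Finset V) (u : V) => do
        tick 1
        let live ← coin (G.prob (u, v))
        if live = true ∧ u ∉ st.2 then pure (st.1 ++ [u], insert u st.2) else pure st)
      (queue, R)
    reverseBFS G Vi fuel st.1 st.2

/-- Generate a random mRR-set of the subgraph induced by `Vi` for the shortfall `ηi`: the number of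
roots is `⌊ni / ηi⌋ + 1` with probability `ni / ηi - ⌊ni / ηi⌋` and `⌊ni / ηi⌋` otherwise, where
`ni = Vi.card`. The last steps store the set and clear the marks of its nodes. -/
noncomputable def mrrSet (G : ProbGraph V) (Vi : Finset V) (ηi : ℕ) : RandCost (Finset V) := do
  tick 1
  let x : ℝ := (Vi.card : ℝ) / ηi
  let extra ← coin (x - (⌊x⌋₊ : ℝ))
  let K ← drawNodes Vi (⌊x⌋₊ + if extra = true then 1 else 0) ∅
  let R ← reverseBFS G Vi Vi.card K.toList K
  tick R.card
  pure R

/-- Generate independently a given number of random mRR-sets. -/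
noncomputable def mrrSets (G : ProbGraph V) (Vi : Finset V) (ηi : ℕ) :
    ℕ → RandCost (List (Finset V))
  | 0 => pure []
  | N + 1 => do
    let R ← mrrSet G Vi ηi
    let F ← mrrSets G Vi ηi N
    pure (R :: F)

/-! ### The greedy algorithm for maximum coverage -/

/-- The main loop of the greedy algorithm: `k` times, scan the nodes of `Vi` not chosen yet for one
that lies in the largest number `cnt` of uncovered sets, choose it, and then go through the list
`idx` of the sets that contain it; each of them that is not covered yet becomes covered, and the
counters of its nodes are decreased. -/
noncomputable def greedyLoop (Vi : Finset V) (F : List (Finset V)) (idx : V → List ℕ) :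
    ℕ → (V → ℕ) → (ℕ → Bool) → Finset V → RandCost (Finset V)
  | 0, _, _, S => pure S
  | k + 1, cnt, covered, S => do
    tick (Vi.card + 1)
    match (Vi \ S).toList.argmax cnt with
    | none => pure S
    | some v => do
      let st ← (idx v).foldlM
        (fun (st : (V → ℕ) × (ℕ → Bool)) (j : ℕ) => do
          tick 1
          if st.2 j = true then pure st
          else do
            let R := F.getD j ∅
            tick R.card
            pure (fun u => if u ∈ R then st.1 u - 1 else st.1 u, Function.update st.2 j true))
        (cnt, covered)
      greedyLoop Vi F idx k st.1 st.2 (insert v S)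

/-- The greedy algorithm that selects `b` nodes of `Vi` for covering the sets in `F`. It first
reads `F` to compute for every node the number of the sets that contain it, and the list of their
indices. -/
noncomputable def greedy (Vi : Finset V) (F : List (Finset V)) (b : ℕ) :
    RandCost (Finset V) := do
  tick Vi.card
  let st ← F.zipIdx.foldlM
    (fun (st : (V → ℕ) × (V → List ℕ)) (Rj : Finset V × ℕ) => do
      tick (Rj.1.card + 1)
      pure (fun u => if u ∈ Rj.1 then st.1 u + 1 else st.1 u,
        fun u => if u ∈ Rj.1 then Rj.2 :: st.2 u else st.2 u))
    (fun _ => 0, fun _ => [])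
  greedyLoop Vi F st.2 b st.1 (fun _ => false) ∅

/-- The coverage of `S` in `F`: the number of the sets in `F` that intersect `S`. -/
noncomputable def coverage (F : List (Finset V)) (S : Finset V) : RandCost ℕ :=
  F.foldlM
    (fun (acc : ℕ) (R : Finset V) => do
      tick (R.card + 1)
      pure (if (R ∩ S).Nonempty then acc + 1 else acc))
    0

/-! ### TRIM-B -/

/-- The failure probability `δ` used for the shortfall `ηi`. -/
noncomputable def delta (ε : ℝ) (ηi : ℕ) : ℝ :=
  ε / (100 * (1 - 1 / Real.exp 1) * (1 - ε) * ηi)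

/-- The corrected error threshold. -/
noncomputable def epsHat (ε : ℝ) : ℝ := 99 * ε / (100 - ε)

/-- The approximation ratio `1 - (1 - 1/b) ^ b` of the greedy algorithm. -/
noncomputable def rho (b : ℕ) : ℝ := 1 - (1 - 1 / (b : ℝ)) ^ b

/-- The maximum number of mRR-sets. -/
noncomputable def thetaMax (ε : ℝ) (ni ηi b : ℕ) : ℝ :=
  2 * ni * (√(Real.log (6 / delta ε ηi))
    + √((Real.log (ni.choose b) + Real.log (6 / delta ε ηi)) / rho b)) ^ 2 / (b * epsHat ε ^ 2)

/-- The initial number of mRR-sets. -/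
noncomputable def thetaInit (ε : ℝ) (ni ηi b : ℕ) : ℝ :=
  thetaMax ε ni ηi b * (b * epsHat ε ^ 2) / ni

/-- The maximum number of iterations. -/
noncomputable def maxIter (ε : ℝ) (ni ηi b : ℕ) : ℕ :=
  ⌈Real.logb 2 (thetaMax ε ni ηi b / thetaInit ε ni ηi b)⌉₊ + 1

/-- The parameter `a₂`. -/
noncomputable def aTwo (ε : ℝ) (ni ηi b : ℕ) : ℝ :=
  Real.log (3 * maxIter ε ni ηi b / delta ε ηi)

/-- The parameter `a₁`. -/
noncomputable def aOne (ε : ℝ) (ni ηi b : ℕ) : ℝ :=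
  Real.log (3 * maxIter ε ni ηi b / delta ε ηi) + Real.log (ni.choose b)

/-- The lower bound on the expected coverage of a set whose coverage is `Λ`. -/
noncomputable def coverLower (a₁ Λ : ℝ) : ℝ :=
  (√(Λ + 2 * a₁ / 9) - √(a₁ / 2)) ^ 2 - a₁ / 18

/-- The upper bound on the expected coverage of an optimal set, if `Λ` is the coverage of the
greedy set. -/
noncomputable def coverUpper (a₂ ρ Λ : ℝ) : ℝ :=
  (√(Λ / ρ + a₂ / 2) + √(a₂ / 2)) ^ 2

/-- The iterations of TRIM-B on the mRR-sets `F` generated so far; the first argument is the number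
of iterations that may still follow the current one. -/
noncomputable def trimBLoop (G : ProbGraph V) (Vi : Finset V) (ηi b : ℕ) (ε : ℝ) :
    ℕ → List (Finset V) → RandCost (Finset V)
  | 0, F => greedy Vi F b
  | k + 1, F => do
    let S ← greedy Vi F b
    let Λ ← coverage F S
    tick 1
    if rho b * (1 - epsHat ε) ≤
        coverLower (aOne ε Vi.card ηi b) Λ / coverUpper (aTwo ε Vi.card ηi b) (rho b) Λ then
      pure S
    else do
      let F' ← mrrSets G Vi ηi F.length
      trimBLoop G Vi ηi b ε k (F ++ F')

/-- TRIM-B on the subgraph induced by `Vi`, with shortfall `ηi`, batch size `b` and error threshold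
`ε`. The initial steps compute the parameters (the logarithm of the binomial coefficient as a sum of
`b` terms) and clear the marks of the nodes. -/
noncomputable def trimB (G : ProbGraph V) (Vi : Finset V) (ηi b : ℕ) (ε : ℝ) :
    RandCost (Finset V) := do
  tick (Vi.card + b + 1)
  let F ← mrrSets G Vi ηi ⌈thetaInit ε Vi.card ηi b⌉₊
  trimBLoop G Vi ηi b ε (maxIter ε Vi.card ηi b - 1) F

/-! ### ASTI instantiated with TRIM-B -/

/-- One round of ASTI with target `η` and batch size `b`, when `Vi` is the set of inactive nodes and
`φ` is the set of live edges: select a batch with TRIM-B (all of `Vi` if fewer than `b` nodes are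
left), observe the nodes it activates, and remove them. Returns the batch and the new set of
inactive nodes. The last steps are a traversal of the residual graph in order to update it. -/
noncomputable def astiRound (G : ProbGraph V) (η b : ℕ) (ε : ℝ) (φ : Finset (V × V))
    (Vi : Finset V) : RandCost (Finset V × Finset V) := do
  let B ← trimB G Vi (η - (Fintype.card V - Vi.card)) (min b Vi.card) ε
  tick (Vi.card + G.edgeCount Vi + 1)
  pure (B, Vi \ influenced Vi φ B)

/-- What a run of ASTI returns: the seed set, the set of nodes that are still inactive, and the
number of rounds. -/
structure AstiResult (V : Type) where
  seeds : Finset V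
  inactive : Finset V
  rounds : ℕ

/-- The rounds of ASTI, which go on until at least `η` nodes are active. The first argument bounds
the number of rounds. -/
noncomputable def astiLoop (G : ProbGraph V) (η b : ℕ) (ε : ℝ) (φ : Finset (V × V)) :
    ℕ → AstiResult V → RandCost (AstiResult V)
  | 0, st => pure st
  | fuel + 1, st =>
    if η ≤ Fintype.card V - st.inactive.card then pure st
    else do
      let r ← astiRound G η b ε φ st.inactive
      astiLoop G η b ε φ fuel ⟨st.seeds ∪ r.1, r.2, st.rounds + 1⟩

/-- ASTI instantiated with TRIM-B, when `φ` is the (unknown) set of live edges. Every round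
activates a new node, so the bound `Fintype.card V` on the number of rounds is never effective. -/
noncomputable def asti (G : ProbGraph V) (η b : ℕ) (ε : ℝ) (φ : Finset (V × V)) :
    RandCost (AstiResult V) :=
  astiLoop G η b ε φ (Fintype.card V) ⟨∅, Finset.univ, 0⟩

/-- The expected running time of ASTI instantiated with TRIM-B, over the random realization of the
network and the random choices of the algorithm. -/
noncomputable def expectedTime (G : ProbGraph V) (η b : ℕ) (ε : ℝ) : ℝ≥0∞ :=
  ∑ φ ∈ G.edges.powerset, ENNReal.ofReal (G.realizationProb φ) * (asti G η b ε φ).expectedCost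

end ASM

/-! The quality of the batches plays no role; the time bound rests on a balance between the cost of
an mRR-set and the number of mRR-sets needed.

Let `E` be the expected cost of one mRR-set and `W = 5 * ni + 2 * mi`. All steps of a reverse search
can be charged to the nodes of the resulting set, and the charges of all nodes add up to `W`. Hence
`E ≤ p * W` as soon as `p` bounds the probability that a given node lies in the set
(`mean_mrrSet_le`). Let `O` be a set of `b` nodes with the largest probability `p` of being hit;
every node lies in some set of `b` nodes, so this `p` qualifies (`exists_max_hitProb`).

The stopping test succeeds deterministically once the greedy set covers `M / 2` sets, for some `M =
O(b ln n / ε²)` (`le_coverLower_div_coverUpper`, `ParamRange.stop_of_le`). Greedy reaches at least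
half the coverage of `O` (`post_greedy`, `half_le_rho`), so another doubling requires that the fixed
set `O` hits fewer than `M` of the sets. With `N` independent sets this is exponentially unlikely
beyond `N ≈ M / p`, so the sample size at the end is `O(M / p)` in expectation, up to the initial
size. Since `E ≤ p * W`, the factor `p` cancels and sampling costs `O(M * W)`.

Set sizes are correlated with the event that `O` is rarely hit, so the tail bound is proved with the
total size as a weight (`mean_sum_of_coverCount_lt_le`), and a potential function sums the resulting
bounds over the doublings (`mean_continuation_le`).

Finally, a round activates at least its whole batch, so `⌈η / b⌉` rounds suffice. The bound on a
round is uniform in the residual graph and in the realization, so adaptivity causes no difficulty,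
and the bounds of the rounds add up. -/

namespace ASM

/-! ### Expectations and postconditions of randomized computations with a step counter. -/

namespace RandCost

variable {α β : Type}

/-- The expectation of a function of the value and of the number of steps. -/
noncomputable def expect (x : RandCost α) (f : α × ℕ → ℝ≥0∞) : ℝ≥0∞ :=
  ∑' r : α × ℕ, (show PMF (α × ℕ) from x) r * f r

/-- The expectation of a function of the value. -/
noncomputable def mean (x : RandCost α) (f : α → ℝ≥0∞) : ℝ≥0∞ := x.expect fun r => f r.1

/-- Every outcome satisfies `P`. -/
def Post (x : RandCost α) (P : α → ℕ → Prop) : Prop := ∀ r ∈ x.outcomes, P r.1 r.2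

theorem expectedCost_eq_expect (x : RandCost α) :
    x.expectedCost = x.expect fun r => (r.2 : ℝ≥0∞) := rfl

theorem tsum_bind_mul {γ δ : Type} (p : PMF γ) (q : γ → PMF δ) (f : δ → ℝ≥0∞) :
    ∑' r, (p.bind q) r * f r = ∑' a, p a * ∑' r, q a r * f r := by
  simp only [PMF.bind_apply, ← ENNReal.tsum_mul_right, ← ENNReal.tsum_mul_left]
  rw [ENNReal.tsum_comm]
  simp only [mul_assoc]

theorem tsum_pure_mul {γ : Type} (a : γ) (f : γ → ℝ≥0∞) :
    ∑' r, (PMF.pure a) r * f r = f a := by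
  rw [tsum_eq_single a]
  · simp
  · intro b hb
    simp [PMF.pure_apply, hb]

theorem tsum_map_mul {γ δ : Type} (p : PMF γ) (h : γ → δ) (f : δ → ℝ≥0∞) :
    ∑' r, (p.map h) r * f r = ∑' a, p a * f (h a) := by
  unfold PMF.map
  rw [tsum_bind_mul]
  simp only [Function.comp_apply, tsum_pure_mul]

theorem expect_pure (a : α) (f : α × ℕ → ℝ≥0∞) :
    (pure a : RandCost α).expect f = f (a, 0) :=
  tsum_pure_mul (a, 0) f

theorem expect_bind (x : RandCost α) (g : α → RandCost β) (f : β × ℕ → ℝ≥0∞) :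
    (x >>= g).expect f = x.expect fun a => (g a.1).expect fun r => f (r.1, a.2 + r.2) := by
  refine (tsum_bind_mul (γ := α × ℕ) (δ := β × ℕ) x _ f).trans (tsum_congr fun a => ?_)
  exact congrArg _ (tsum_map_mul (γ := β × ℕ) (g a.1) _ f)

theorem expect_mono_of_post {x : RandCost α} {P : α → ℕ → Prop} (h : x.Post P)
    {f g : α × ℕ → ℝ≥0∞} (hfg : ∀ a k, P a k → f (a, k) ≤ g (a, k)) :
    x.expect f ≤ x.expect g := by
  refine ENNReal.tsum_le_tsum fun r => ?_
  by_cases hr : (show PMF (α × ℕ) from x) r = 0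
  · simp only [hr, zero_mul, le_refl]
  · exact mul_le_mul_right (hfg r.1 r.2 (h r hr)) _

theorem expect_mono (x : RandCost α) {f g : α × ℕ → ℝ≥0∞} (hfg : ∀ r, f r ≤ g r) :
    x.expect f ≤ x.expect g :=
  ENNReal.tsum_le_tsum fun r => mul_le_mul_right (hfg r) _

theorem expect_const (x : RandCost α) (c : ℝ≥0∞) : (x.expect fun _ => c) = c := by
  unfold expect
  rw [ENNReal.tsum_mul_right]
  exact (congrArg (· * c) (PMF.tsum_coe x)).trans (one_mul c)

theorem expect_add (x : RandCost α) (f g : α × ℕ → ℝ≥0∞) :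
    (x.expect fun r => f r + g r) = x.expect f + x.expect g := by
  unfold expect
  simp only [mul_add, ENNReal.tsum_add]

theorem expect_const_mul (x : RandCost α) (c : ℝ≥0∞) (f : α × ℕ → ℝ≥0∞) :
    (x.expect fun r => c * f r) = c * x.expect f := by
  unfold expect
  rw [← ENNReal.tsum_mul_left]
  exact tsum_congr fun r => mul_left_comm _ _ _

theorem mean_pure (a : α) (f : α → ℝ≥0∞) : (pure a : RandCost α).mean f = f a :=
  expect_pure a _

theorem mean_bind (x : RandCost α) (g : α → RandCost β) (f : β → ℝ≥0∞) :
    (x >>= g).mean f = x.mean fun a => (g a).mean f :=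
  expect_bind x g _

theorem mean_mono (x : RandCost α) {f g : α → ℝ≥0∞} (hfg : ∀ a, f a ≤ g a) :
    x.mean f ≤ x.mean g :=
  x.expect_mono fun r => hfg r.1

theorem mean_const (x : RandCost α) (c : ℝ≥0∞) : (x.mean fun _ => c) = c :=
  x.expect_const c

theorem mean_add (x : RandCost α) (f g : α → ℝ≥0∞) :
    (x.mean fun a => f a + g a) = x.mean f + x.mean g :=
  x.expect_add _ _

theorem mean_const_mul (x : RandCost α) (c : ℝ≥0∞) (f : α → ℝ≥0∞) :
    (x.mean fun a => c * f a) = c * x.mean f :=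
  x.expect_const_mul c _

theorem mean_mul_const (x : RandCost α) (c : ℝ≥0∞) (f : α → ℝ≥0∞) :
    (x.mean fun a => f a * c) = x.mean f * c := by
  simp only [mul_comm _ c, mean_const_mul]

theorem mean_finset_sum {ι : Type} (x : RandCost α) (s : Finset ι) (f : ι → α → ℝ≥0∞) :
    (x.mean fun a => ∑ i ∈ s, f i a) = ∑ i ∈ s, x.mean (f i) := by
  classical
  induction s using Finset.induction_on with
  | empty => simpa using x.mean_const 0
  | insert i s hi ih => simp only [Finset.sum_insert hi, mean_add, ih]

theorem expectedCost_pure (a : α) : (pure a : RandCost α).expectedCost = 0 := by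
  rw [expectedCost_eq_expect, expect_pure, Nat.cast_zero]

theorem expectedCost_bind (x : RandCost α) (g : α → RandCost β) :
    (x >>= g).expectedCost = x.expectedCost + x.mean fun a => (g a).expectedCost := by
  rw [expectedCost_eq_expect, expect_bind]
  simp only [Nat.cast_add, expect_add, expect_const]
  rfl

theorem Post.mono {x : RandCost α} {P Q : α → ℕ → Prop} (h : x.Post P)
    (hPQ : ∀ a k, P a k → Q a k) : x.Post Q :=
  fun r hr => hPQ _ _ (h r hr)

theorem post_pure {a : α} {P : α → ℕ → Prop} (h : P a 0) : (pure a : RandCost α).Post P := by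
  intro r hr
  have : r = (a, 0) := (PMF.mem_support_pure_iff (a, 0) r).1 hr
  subst this
  exact h

theorem Post.bind {x : RandCost α} {g : α → RandCost β} {Q : α → ℕ → Prop}
    {P : β → ℕ → Prop} (hx : x.Post Q)
    (hg : ∀ a k, Q a k → (g a).Post fun b l => P b (k + l)) : (x >>= g).Post P := by
  intro r hr
  obtain ⟨a, ha, hr⟩ := (PMF.mem_support_bind_iff _ _ r).1 hr
  obtain ⟨s, hs, rfl⟩ := (PMF.mem_support_map_iff _ _ r).1 hr
  exact hg a.1 a.2 (hx a ha) s hs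

theorem expectedCost_le_of_post {x : RandCost α} {B : ℕ} (h : x.Post fun _ k => k ≤ B) :
    x.expectedCost ≤ B :=
  (expect_mono_of_post h fun _ _ hk => Nat.cast_le.2 hk).trans_eq (x.expect_const _)

theorem mean_mono_of_post {x : RandCost α} {P : α → ℕ → Prop} (h : x.Post P)
    {f g : α → ℝ≥0∞} (hfg : ∀ a k, P a k → f a ≤ g a) : x.mean f ≤ x.mean g :=
  expect_mono_of_post h hfg

theorem mean_le_of_post {x : RandCost α} {P : α → ℕ → Prop} (h : x.Post P)
    {f : α → ℝ≥0∞} {B : ℝ≥0∞} (hf : ∀ a k, P a k → f a ≤ B) : x.mean f ≤ B :=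
  (mean_mono_of_post h hf).trans_eq (x.mean_const B)

/-- The rule for a loop over a list: an invariant `I` on the elements that remain, the state and
the number of steps. -/
theorem post_foldlM {σ ι : Type} (f : σ → ι → RandCost σ) (I : List ι → σ → ℕ → Prop)
    (hstep : ∀ i l s k, I (i :: l) s k → (f s i).Post fun s' j => I l s' (k + j)) :
    ∀ (l : List ι) (s : σ) (k : ℕ), I l s k →
      (l.foldlM f s).Post fun s' j => I [] s' (k + j) := by
  intro l
  induction l with
  | nil =>
    intro s k h
    exact post_pure h
  | cons i l ih =>
    intro s k h
    rw [List.foldlM_cons]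
    refine (hstep i l s k h).bind fun s' j hj => ?_
    simpa only [add_assoc] using ih s' (k + j) hj

end RandCost

open RandCost

theorem post_tick {k : ℕ} {P : Unit → ℕ → Prop} (h : P () k) : (tick k).Post P := by
  intro r hr
  have : r = ((), k) := (PMF.mem_support_pure_iff ((), k) r).1 hr
  subst this
  exact h

theorem post_tick_bind {β : Type} {k : ℕ} {g : Unit → RandCost β} {P : β → ℕ → Prop}
    (h : (g ()).Post fun b l => P b (k + l)) : (tick k >>= g).Post P :=
  (post_tick (P := fun _ j => j = k) rfl).bind fun _ _ hj => hj ▸ h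

theorem post_sample {α : Type} {p : PMF α} {P : α → ℕ → Prop} (h : ∀ a ∈ p.support, P a 1) :
    (sample p).Post P := by
  intro r hr
  obtain ⟨a, ha, rfl⟩ := (PMF.mem_support_map_iff _ _ r).1 hr
  exact h a ha

theorem post_coin {q : ℝ} {P : Bool → ℕ → Prop} (h : ∀ a, P a 1) : (coin q).Post P :=
  post_sample fun a _ => h a

theorem expectedCost_tick_bind {β : Type} (k : ℕ) (g : Unit → RandCost β) :
    (tick k >>= g).expectedCost = k + (g ()).expectedCost := by
  have h (f : Unit × ℕ → ℝ≥0∞) : (tick k).expect f = f ((), k) := tsum_pure_mul ((), k) f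
  rw [expectedCost_bind, expectedCost_eq_expect, h]
  exact congrArg _ (h _)

end ASM

/-! ### The cost of generating mRR-sets. -/

namespace ASM
variable {V : Type} [DecidableEq V]

open RandCost

/-- Every step draws a node that is new, so the steps are paid for by the growth of the set. -/
theorem post_drawNodes (Vi : Finset V) (n : ℕ) (K : Finset V) (hK : K ⊆ Vi) :
    (drawNodes Vi n K).Post fun K' k =>
      K ⊆ K' ∧ K' ⊆ Vi ∧ K'.card = K.card + k ∧ (1 ≤ n → Vi.Nonempty → K'.Nonempty) := by
  induction n generalizing K with
  | zero =>
    exact post_pure ⟨subset_rfl, hK, rfl, by omega⟩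
  | succ n ih =>
    rw [drawNodes]
    split_ifs with h
    · refine (post_sample (P := fun v k => v ∈ Vi \ K ∧ k = 1) fun v hv => ⟨?_, rfl⟩).bind ?_
      · exact (PMF.mem_support_uniformOfFinset_iff h v).1 hv
      · rintro v _ ⟨hv, rfl⟩
        rw [Finset.mem_sdiff] at hv
        refine (ih (insert v K) (Finset.insert_subset hv.1 hK)).mono ?_
        rintro K' k ⟨h1, h2, h3, -⟩
        rw [Finset.card_insert_of_notMem hv.2] at h3
        exact ⟨(Finset.subset_insert _ _).trans h1, h2, by omega,
          fun _ _ => ⟨v, h1 (Finset.mem_insert_self _ _)⟩⟩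
    · refine post_pure ⟨subset_rfl, hK, rfl, fun _ hV => ?_⟩
      by_contra hne
      rw [Finset.not_nonempty_iff_eq_empty] at hne
      exact h (by simpa [hne] using hV)

/-- The number of steps for processing a node in the reverse breadth first search. -/
noncomputable def processCost (G : ProbGraph V) (Vi : Finset V) (v : V) : ℕ :=
  1 + 2 * (G.inNeighbors Vi v).length

theorem sum_length_inNeighbors (G : ProbGraph V) (Vi : Finset V) :
    ∑ v ∈ Vi, (G.inNeighbors Vi v).length = G.edgeCount Vi := by
  unfold ProbGraph.edgeCount ProbGraph.inNeighbors
  rw [Finset.card_eq_sum_card_fiberwise (f := Prod.snd) (t := Vi)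
    (fun e he => (Finset.mem_filter.1 he).2.2)]
  refine Finset.sum_congr rfl fun v hv => ?_
  rw [Finset.length_toList]
  refine Finset.card_bij' (fun u _ => (u, v)) (fun e _ => e.1) ?_ ?_ ?_ ?_
  · intro u hu
    simp only [Finset.mem_filter] at hu ⊢
    exact ⟨⟨hu.2, hu.1, hv⟩, trivial⟩
  · rintro ⟨u, w⟩ he
    simp only [Finset.mem_filter] at he ⊢
    obtain ⟨⟨h1, h2, -⟩, rfl⟩ := he
    exact ⟨h2, h1⟩
  · intro u _
    rfl
  · rintro ⟨u, w⟩ he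
    simp only [Finset.mem_filter] at he
    rw [← he.2]

theorem sum_processCost (G : ProbGraph V) (Vi : Finset V) :
    ∑ v ∈ Vi, processCost G Vi v = Vi.card + 2 * G.edgeCount Vi := by
  simp only [processCost, Finset.sum_add_distrib, ← Finset.mul_sum, sum_length_inNeighbors]
  simp

/-- In the search, `D` is the set of the nodes that have been processed, and the queue holds the
other nodes visited so far. -/
theorem post_reverseBFS (G : ProbGraph V) (Vi : Finset V) (fuel : ℕ) (q : List V)
    (D R : Finset V) (hq : q.Nodup) (hqD : ∀ v ∈ q, v ∉ D) (hR : R = D ∪ q.toFinset)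
    (hRV : R ⊆ Vi) :
    (reverseBFS G Vi fuel q R).Post fun R' k =>
      R ⊆ R' ∧ R' ⊆ Vi ∧ k ≤ ∑ v ∈ R' \ D, processCost G Vi v := by
  induction fuel generalizing q D R with
  | zero => exact post_pure ⟨subset_rfl, hRV, Nat.zero_le _⟩
  | succ fuel ih =>
    cases q with
    | nil => exact post_pure ⟨subset_rfl, hRV, Nat.zero_le _⟩
    | cons v q =>
      rw [reverseBFS]
      refine post_tick_bind ?_
      rw [List.nodup_cons] at hq
      have hvD : v ∉ D := hqD v List.mem_cons_self
      -- Each incoming edge costs two steps, the examination and the coin; the last clause of the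
      -- invariant counts them exactly.
      refine (post_foldlM _ (fun l (st : List V × Finset V) k =>
        (∀ u ∈ l, u ∈ Vi) ∧ st.1.Nodup ∧ (∀ u ∈ st.1, u ∉ insert v D) ∧
        st.2 = insert v D ∪ st.1.toFinset ∧ R ⊆ st.2 ∧ st.2 ⊆ Vi ∧
        k + 2 * l.length = 2 * (G.inNeighbors Vi v).length) ?_ _ _ 0 ?_).bind ?_
      · rintro u l ⟨q', R'⟩ k ⟨h1, h2, h3, h4, h5, h6, h7⟩
        simp only [List.length_cons] at h2 h3 h4 h5 h6 h7
        refine post_tick_bind ((post_coin (P := fun _ k => k = 1) fun _ => rfl).bind ?_)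
        rintro live _ rfl
        split_ifs with h
        · have hu : u ∉ R' := h.2
          refine post_pure ⟨fun w hw => h1 w (List.mem_cons_of_mem _ hw), ?_, ?_, ?_, ?_, ?_, ?_⟩
          · refine List.nodup_append.2 ⟨h2, List.nodup_singleton u, ?_⟩
            rintro a ha b hb rfl
            rw [List.mem_singleton] at hb
            subst hb
            exact hu (by rw [h4]; exact Finset.mem_union_right _ (List.mem_toFinset.2 ha))
          · intro w hw
            rcases List.mem_append.1 hw with hw | hw
            · exact h3 w hw
            · rw [List.mem_singleton] at hw
              subst hw
              exact fun hw => hu (by rw [h4]; exact Finset.mem_union_left _ hw)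
          · rw [h4]
            ext w
            simp only [Finset.mem_insert, Finset.mem_union, List.mem_toFinset, List.mem_append,
              List.mem_singleton]
            tauto
          · exact h5.trans (Finset.subset_insert _ _)
          · exact Finset.insert_subset (h1 u List.mem_cons_self) h6
          · omega
        · refine post_pure ⟨fun w hw => h1 w (List.mem_cons_of_mem _ hw), h2, h3, h4, h5, h6, ?_⟩
          omega
      · refine ⟨fun u hu => ?_, hq.2, fun u hu => ?_, ?_, subset_rfl, hRV, by simp⟩
        · exact (Finset.mem_filter.1 (Finset.mem_toList.1 hu)).1
        · rw [Finset.mem_insert, not_or]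
          refine ⟨?_, hqD u (List.mem_cons_of_mem _ hu)⟩
          rintro rfl
          exact hq.1 hu
        · rw [hR]
          ext w
          simp only [Finset.mem_insert, Finset.mem_union, List.mem_toFinset, List.mem_cons]
          tauto
      · rintro ⟨q', R'⟩ k ⟨-, h2, h3, h4, h5, h6, h7⟩
        simp only [List.length_nil, mul_zero, add_zero, zero_add] at h7 ⊢
        refine (ih q' (insert v D) R' h2 h3 h4 h6).mono ?_
        rintro R'' k' ⟨g1, g2, g3⟩
        refine ⟨h5.trans g1, g2, ?_⟩
        -- The cost of processing `v` is charged to `v`, which leaves the sum over `R'' \ D` when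
        -- `v` joins the processed nodes.
        have hv : v ∈ R'' \ D := by
          refine Finset.mem_sdiff.2 ⟨g1 (h5 ?_), hvD⟩
          rw [hR]
          simp
        rw [← Finset.add_sum_erase _ _ hv, ← Finset.sdiff_insert]
        simp only [processCost] at g3 ⊢
        omega

/-- Outside the search there are two initial steps, one step per root, and one step per node of `R`
at the end. As `R` is nonempty, this is at most `4` per node of `R`. Nonemptiness comes from `ηi ≤
Vi.card`, which forces at least one root. -/
theorem post_mrrSet (G : ProbGraph V) (Vi : Finset V) (ηi : ℕ) (hη : 1 ≤ ηi)
    (hηV : ηi ≤ Vi.card) :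
    (mrrSet G Vi ηi).Post fun R k =>
      R ⊆ Vi ∧ R.Nonempty ∧ R.card ≤ k ∧ k ≤ ∑ v ∈ R, (4 + processCost G Vi v) := by
  unfold mrrSet
  refine post_tick_bind ((post_coin (P := fun _ k => k = 1) fun _ => rfl).bind ?_)
  rintro extra _ rfl
  refine (post_drawNodes Vi _ ∅ (Finset.empty_subset _)).bind ?_
  rintro K k₁ ⟨-, hKV, hKc, hKne⟩
  refine (post_reverseBFS G Vi _ _ ∅ K (Finset.nodup_toList K) (by simp) (by simp) hKV).bind ?_
  rintro R k₂ ⟨hKR, hRV, hk₂⟩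
  refine post_tick_bind (post_pure ?_)
  have hfl : 1 ≤ ⌊(Vi.card : ℝ) / ηi⌋₊ := by
    refine Nat.le_floor ?_
    rw [Nat.cast_one, le_div_iff₀ (by exact_mod_cast hη), one_mul]
    exact_mod_cast hηV
  have hK : K.Nonempty := hKne (by omega) (Finset.card_pos.1 (by omega))
  have h1 := Finset.card_le_card hKR
  have h2 := hK.card_pos
  simp only [Finset.sdiff_empty, Finset.card_empty] at hk₂ hKc
  refine ⟨hRV, hK.mono hKR, by omega, ?_⟩
  rw [Finset.sum_add_distrib, Finset.sum_const, smul_eq_mul]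
  omega

/-- Linearity of expectation: each node contributes its charge times the probability that it belongs
to the mRR-set. -/
theorem mean_mrrSet_le (G : ProbGraph V) (Vi : Finset V) (ηi : ℕ) (hη : 1 ≤ ηi)
    (hηV : ηi ≤ Vi.card) (p : ℝ≥0∞)
    (hp : ∀ v ∈ Vi, ((mrrSet G Vi ηi).mean fun R => if v ∈ R then 1 else 0) ≤ p) :
    (mrrSet G Vi ηi).expectedCost ≤ p * (5 * Vi.card + 2 * G.edgeCount Vi : ℕ) := by
  have hsum : ∑ v ∈ Vi, (4 + processCost G Vi v) = 5 * Vi.card + 2 * G.edgeCount Vi := by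
    rw [Finset.sum_add_distrib, sum_processCost, Finset.sum_const, smul_eq_mul]
    omega
  calc (mrrSet G Vi ηi).expectedCost
      ≤ (mrrSet G Vi ηi).mean fun R =>
          ∑ v ∈ Vi, (if v ∈ R then 1 else 0) * ((4 + processCost G Vi v : ℕ) : ℝ≥0∞) := by
        refine expect_mono_of_post (post_mrrSet G Vi ηi hη hηV) ?_
        rintro R k ⟨hRV, -, -, hk⟩
        refine (Nat.cast_le.2 hk).trans ?_
        simp only [ite_mul, one_mul, zero_mul]
        rw [← Finset.sum_filter, Finset.filter_mem_eq_inter, Finset.inter_eq_right.2 hRV,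
          Nat.cast_sum]
    _ ≤ ∑ v ∈ Vi, p * ((4 + processCost G Vi v : ℕ) : ℝ≥0∞) := by
        rw [mean_finset_sum]
        refine Finset.sum_le_sum fun v hv => ?_
        rw [mean_mul_const]
        exact mul_le_mul_left (hp v hv) _
    _ = p * (5 * Vi.card + 2 * G.edgeCount Vi : ℕ) := by
        rw [← Finset.mul_sum, ← Nat.cast_sum, hsum]

/-- This lets a doubled list be treated as one fresh sample of twice the size. -/
theorem mean_mrrSets_add (G : ProbGraph V) (Vi : Finset V) (ηi M N : ℕ)
    (f : List (Finset V) → ℝ≥0∞) :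
    (mrrSets G Vi ηi (M + N)).mean f =
      (mrrSets G Vi ηi M).mean fun F => (mrrSets G Vi ηi N).mean fun F' => f (F ++ F') := by
  induction M generalizing f with
  | zero => simp only [mrrSets, zero_add, mean_pure, List.nil_append]
  | succ M ih =>
    rw [Nat.add_right_comm]
    simp only [mrrSets, mean_bind, mean_pure, ih, List.cons_append]

theorem expectedCost_mrrSets (G : ProbGraph V) (Vi : Finset V) (ηi N : ℕ) :
    (mrrSets G Vi ηi N).expectedCost = N * (mrrSet G Vi ηi).expectedCost := by
  induction N with
  | zero => simp [mrrSets, expectedCost_pure]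
  | succ N ih =>
    simp only [mrrSets, expectedCost_bind, expectedCost_pure, ih, mean_const, add_zero]
    push_cast
    ring

theorem post_mrrSets (G : ProbGraph V) (Vi : Finset V) (ηi N : ℕ) :
    (mrrSets G Vi ηi N).Post fun F _ => F.length = N := by
  induction N with
  | zero => exact post_pure rfl
  | succ N ih =>
    refine Post.bind (Q := fun _ _ => True) (fun _ _ => trivial) fun R _ _ => ?_
    exact ih.bind fun F _ hF => post_pure (congrArg (· + 1) hF)

end ASM

/-! ### The greedy algorithm: approximation ratio and linear running time. -/

namespace ASM
variable {V : Type}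

open RandCost

/-- The size of the list `F`, as read by the algorithms. -/
def listSize (F : List (Finset V)) : ℕ := (F.map fun R => R.card + 1).sum

theorem listSize_cons (R : Finset V) (F : List (Finset V)) :
    listSize (R :: F) = R.card + 1 + listSize F := rfl

theorem listSize_append (F F' : List (Finset V)) :
    listSize (F ++ F') = listSize F + listSize F' := by
  rw [listSize, List.map_append, List.sum_append, listSize, listSize]

theorem sum_map_eq_sum_range {α : Type} (F : List α) (d : α) (g : α → ℕ) :
    (F.map g).sum = ∑ j ∈ Finset.range F.length, g (F.getD j d) := by
  induction F with
  | nil => rfl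
  | cons a F ih =>
    rw [List.map_cons, List.sum_cons, List.length_cons, Finset.sum_range_succ', ih, add_comm]
    simp

theorem listSize_eq_sum (F : List (Finset V)) :
    listSize F = (∑ j ∈ Finset.range F.length, (F.getD j ∅).card) + F.length := by
  rw [listSize, sum_map_eq_sum_range F ∅, Finset.sum_add_distrib]
  simp

/-- The indices of the sets in `F` that are not marked as covered. -/
def uncovered (F : List (Finset V)) (covered : ℕ → Bool) : Finset ℕ :=
  (Finset.range F.length).filter fun j => covered j = false

theorem uncovered_update (F : List (Finset V)) (covered : ℕ → Bool) (j : ℕ) :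
    uncovered F (Function.update covered j true) = (uncovered F covered).erase j := by
  ext i
  simp only [uncovered, Finset.mem_filter, Finset.mem_erase, Finset.mem_range,
    Function.update_apply]
  split_ifs with h <;> simp [h]

variable [DecidableEq V]

/-- The number of the sets in `F` that intersect `S`. -/
def coverCount (F : List (Finset V)) (S : Finset V) : ℕ :=
  (F.map fun R => if (R ∩ S).Nonempty then 1 else 0).sum

theorem post_coverage (F : List (Finset V)) (S : Finset V) :
    (coverage F S).Post fun Λ k => Λ = coverCount F S ∧ k = listSize F := by
  refine (post_foldlM _ (fun l (acc : ℕ) k =>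
    acc + coverCount l S = coverCount F S ∧ k + listSize l = listSize F) ?_ F 0 0 ?_).mono ?_
  · rintro R l acc k ⟨h1, h2⟩
    simp only [coverCount, listSize, List.map_cons, List.sum_cons] at h1 h2
    refine post_tick_bind (post_pure ⟨?_, ?_⟩)
    · split_ifs at h1 ⊢ <;> simp only [coverCount] at * <;> omega
    · simp only [listSize]
      omega
  · simp
  · rintro Λ k ⟨h1, h2⟩
    simp only [coverCount, listSize, List.map_nil, List.sum_nil] at h1 h2
    exact ⟨h1, by simpa [listSize] using h2⟩

theorem coverCount_eq_card (F : List (Finset V)) (S : Finset V) :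
    coverCount F S =
      ((Finset.range F.length).filter fun j => (F.getD j ∅ ∩ S).Nonempty).card := by
  rw [coverCount, sum_map_eq_sum_range F ∅, Finset.card_filter]

/-- `idx` lists for every node the indices of the sets that contain it. -/
def IndexSpec (F : List (Finset V)) (idx : V → List ℕ) : Prop :=
  ∀ u, (idx u).Nodup ∧ ∀ j, j ∈ idx u ↔ j < F.length ∧ u ∈ F.getD j ∅

/-- `cnt` holds for every node the number of the uncovered sets that contain it. -/
def CountSpec (F : List (Finset V)) (covered : ℕ → Bool) (cnt : V → ℕ) : Prop :=
  ∀ u, cnt u = ((uncovered F covered).filter fun j => u ∈ F.getD j ∅).card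

/-- The marked sets are those that intersect `S`. -/
def CoveredSpec (F : List (Finset V)) (covered : ℕ → Bool) (S : Finset V) : Prop :=
  ∀ j < F.length, covered j = true ↔ (F.getD j ∅ ∩ S).Nonempty

/-- Amortization: the counters of the nodes of a set are decreased only when the set leaves
`uncovered`, so the total size of the uncovered sets is a potential that pays for it. In the loop
invariant, a set is marked if it meets `S`, or contains `v` and its index has been passed. -/
theorem post_coverSets (F : List (Finset V)) (L : List ℕ) (v : V) (cnt : V → ℕ)
    (covered : ℕ → Bool) (S : Finset V) (hL : L.Nodup)
    (hmem : ∀ j, j ∈ L ↔ j < F.length ∧ v ∈ F.getD j ∅)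
    (hcnt : CountSpec F covered cnt) (hcov : CoveredSpec F covered S) :
    RandCost.Post (L.foldlM
        (fun (st : (V → ℕ) × (ℕ → Bool)) (j : ℕ) => do
          tick 1
          if st.2 j = true then pure st
          else do
            let R := F.getD j ∅
            tick R.card
            pure (fun u => if u ∈ R then st.1 u - 1 else st.1 u, Function.update st.2 j true))
        (cnt, covered)) fun st k =>
      CountSpec F st.2 st.1 ∧ CoveredSpec F st.2 (insert v S) ∧
        k + ∑ j ∈ uncovered F st.2, (F.getD j ∅).card ≤
          L.length + ∑ j ∈ uncovered F covered, (F.getD j ∅).card := by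
  refine (post_foldlM _ (fun l (st : (V → ℕ) × (ℕ → Bool)) k =>
    (∀ j ∈ l, j < F.length ∧ v ∈ F.getD j ∅) ∧ l.Nodup ∧ CountSpec F st.2 st.1 ∧
    (∀ j < F.length, st.2 j = true ↔
      (F.getD j ∅ ∩ S).Nonempty ∨ (v ∈ F.getD j ∅ ∧ j ∉ l)) ∧
    k + l.length + ∑ j ∈ uncovered F st.2, (F.getD j ∅).card ≤
      L.length + ∑ j ∈ uncovered F covered, (F.getD j ∅).card) ?_ L _ 0 ?_).mono ?_
  · rintro j l ⟨c, m⟩ k ⟨h1, h2, h3, h4, h5⟩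
    rw [List.nodup_cons] at h2
    obtain ⟨hj, hvj⟩ := h1 j List.mem_cons_self
    simp only [List.length_cons] at h3 h4 h5
    refine post_tick_bind ?_
    split_ifs with hm
    · refine post_pure ⟨fun i hi => h1 i (List.mem_cons_of_mem _ hi), h2.2, h3, ?_, ?_⟩
      swap
      · simp only
        omega
      intro i hi
      rw [h4 i hi, List.mem_cons, not_or]
      by_cases hij : i = j
      · subst hij
        have := (h4 i hi).1 hm
        tauto
      · tauto
    · have hmem : j ∈ uncovered F m := by
        simpa [uncovered, hj] using hm
      refine post_tick_bind (post_pure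
        ⟨fun i hi => h1 i (List.mem_cons_of_mem _ hi), h2.2, ?_, ?_, ?_⟩)
      · intro u
        simp only [uncovered_update, h3 u, Finset.filter_erase]
        split_ifs with hu
        · rw [Finset.card_erase_of_mem (Finset.mem_filter.2 ⟨hmem, hu⟩)]
        · rw [Finset.erase_eq_of_notMem (a := j) fun h => hu (Finset.mem_filter.1 h).2]
      · intro i hi
        simp only [Function.update_apply]
        split_ifs with hij
        · subst hij
          simp only [true_iff]
          exact Or.inr ⟨hvj, h2.1⟩
        · rw [h4 i hi, List.mem_cons, not_or]
          tauto
      · simp only [uncovered_update]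
        rw [← Finset.add_sum_erase _ _ hmem] at h5
        omega
  · refine ⟨fun j hj => (hmem j).1 hj, hL, hcnt, fun j hj => ?_, by simp⟩
    rw [hcov j hj, hmem j]
    tauto
  · rintro ⟨c, m⟩ k ⟨-, -, h3, h4, h5⟩
    refine ⟨h3, fun j hj => ?_, by simpa using h5⟩
    rw [h4 j hj]
    by_cases hv : v ∈ F.getD j ∅
    · rw [Finset.inter_insert_of_mem hv]
      exact iff_of_true (Or.inr ⟨hv, List.not_mem_nil⟩) (Finset.insert_nonempty _ _)
    · rw [Finset.inter_insert_of_notMem hv]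
      tauto

/-- The counter of `v` is its marginal gain. -/
theorem coverCount_insert {F : List (Finset V)} {covered : ℕ → Bool} {S : Finset V} {v : V}
    (h : CoveredSpec F covered S) :
    coverCount F (insert v S) =
      coverCount F S + ((uncovered F covered).filter fun j => v ∈ F.getD j ∅).card := by
  rw [coverCount_eq_card, coverCount_eq_card, ← Finset.card_union_of_disjoint]
  · congr 1
    ext j
    simp only [Finset.mem_union, Finset.mem_filter, uncovered, Finset.mem_range]
    by_cases hj : j < F.length
    · have h1 := h j hj
      generalize F.getD j ∅ = R at h1 ⊢
      by_cases hv : v ∈ R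
      · rw [Finset.inter_insert_of_mem hv]
        by_cases hm : covered j = true
        · have := h1.1 hm
          simp [hj, this]
        · simp [hj, hv, hm]
      · rw [Finset.inter_insert_of_notMem hv]
        simp [hj, hv]
    · simp [hj]
  · rw [Finset.disjoint_left]
    intro j hj hj'
    simp only [Finset.mem_filter, uncovered, Finset.mem_range] at hj hj'
    have := (h j hj.1).2 hj.2
    simp [this] at hj'

theorem coverCount_mono (F : List (Finset V)) {S T : Finset V} (h : S ⊆ T) :
    coverCount F S ≤ coverCount F T := by
  rw [coverCount_eq_card, coverCount_eq_card]
  exact Finset.card_le_card (Finset.monotone_filter_right _ fun j _ hj =>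
    hj.mono (Finset.inter_subset_inter_left h))

/-- Submodularity: a set hit by `O` is hit by `S` already, or is counted by one of the nodes of `O`.
Nodes of `S` have counter zero, so the bound `g` is needed only outside `S`. -/
theorem coverCount_le_add {F : List (Finset V)} {covered : ℕ → Bool} {S O : Finset V}
    {cnt : V → ℕ} {g : ℕ} (hcnt : CountSpec F covered cnt) (hcov : CoveredSpec F covered S)
    (hg : ∀ o ∈ O, o ∉ S → cnt o ≤ g) :
    coverCount F O ≤ coverCount F S + O.card * g := by
  have hsub : ((Finset.range F.length).filter fun j => (F.getD j ∅ ∩ O).Nonempty) ⊆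
      ((Finset.range F.length).filter fun j => (F.getD j ∅ ∩ S).Nonempty) ∪
      O.biUnion fun o => (uncovered F covered).filter fun j => o ∈ F.getD j ∅ := by
    intro j hj
    obtain ⟨hj, o, ho⟩ := Finset.mem_filter.1 hj
    rw [Finset.mem_inter] at ho
    by_cases hc : covered j = true
    · exact Finset.mem_union_left _
        (Finset.mem_filter.2 ⟨hj, (hcov j (Finset.mem_range.1 hj)).1 hc⟩)
    · refine Finset.mem_union_right _ (Finset.mem_biUnion.2 ⟨o, ho.2, ?_⟩)
      exact Finset.mem_filter.2 ⟨Finset.mem_filter.2 ⟨hj, by simpa using hc⟩, ho.1⟩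
  rw [coverCount_eq_card, coverCount_eq_card]
  refine (Finset.card_le_card hsub).trans ((Finset.card_union_le _ _).trans ?_)
  refine Nat.add_le_add_left (Finset.card_biUnion_le_card_mul _ _ _ fun o ho => ?_) _
  rw [← hcnt o]
  by_cases hS : o ∈ S
  · suffices h : cnt o = 0 by omega
    rw [hcnt o, Finset.card_eq_zero, Finset.filter_eq_empty_iff]
    intro j hj hoj
    obtain ⟨hj, hc⟩ := Finset.mem_filter.1 hj
    have := (hcov j (Finset.mem_range.1 hj)).2 ⟨o, Finset.mem_inter.2 ⟨hoj, hS⟩⟩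
    simp [this] at hc
  · exact hg o ho hS

/-- The classical argument: the best node gains at least a `1 / b` fraction of the gap to `O`, so
each choice shrinks the gap by `1 - 1 / b`. The index list of each node is traversed at most once,
when the node is chosen. -/
theorem post_greedyLoop (Vi : Finset V) (F : List (Finset V)) (idx : V → List ℕ)
    (hidx : IndexSpec F idx) (b : ℕ) (hb : 1 ≤ b) (k : ℕ) (cnt : V → ℕ) (covered : ℕ → Bool)
    (S : Finset V) (hS : S ⊆ Vi) (hcnt : CountSpec F covered cnt)
    (hcov : CoveredSpec F covered S) :
    (greedyLoop Vi F idx k cnt covered S).Post fun S' c =>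
      S' ⊆ Vi ∧ (S.card + k ≤ Vi.card → S'.card = S.card + k) ∧
      (∀ O ⊆ Vi, O.card ≤ b → (coverCount F O : ℝ) - coverCount F S' ≤
        (1 - 1 / (b : ℝ)) ^ k * (coverCount F O - coverCount F S)) ∧
      c ≤ k * (Vi.card + 1) + ∑ v ∈ Vi \ S, (idx v).length +
        ∑ j ∈ uncovered F covered, (F.getD j ∅).card := by
  have hb' : (1 : ℝ) ≤ b := by exact_mod_cast hb
  have hr0 : 0 ≤ 1 - 1 / (b : ℝ) := by
    rw [sub_nonneg, div_le_one (by linarith)]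
    exact hb'
  have hr1 : 1 - 1 / (b : ℝ) ≤ 1 := by
    have : 0 ≤ 1 / (b : ℝ) := by positivity
    linarith
  induction k generalizing cnt covered S with
  | zero =>
    exact post_pure ⟨hS, fun _ => rfl, fun O _ _ => by simp, Nat.zero_le _⟩
  | succ k ih =>
    rw [greedyLoop]
    refine post_tick_bind ?_
    cases hv : (Vi \ S).toList.argmax cnt with
    | none =>
      have hSV : S = Vi := by
        have := List.argmax_eq_none.1 hv
        rw [Finset.toList_eq_nil, Finset.sdiff_eq_empty_iff_subset] at this
        exact hS.antisymm this
      refine post_pure ⟨hS, fun h => ?_, fun O hO _ => ?_, ?_⟩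
      · rw [hSV] at h
        omega
      -- Now `S` is all of `Vi`, so the gap is nonpositive, and a factor at most `1` can only
      -- increase it.
      · have h1 : (coverCount F O : ℝ) ≤ coverCount F S := by
          rw [hSV]
          exact_mod_cast coverCount_mono F hO
        have h2 : (1 - 1 / (b : ℝ)) ^ (k + 1) ≤ 1 := pow_le_one₀ hr0 hr1
        nlinarith
      · have : Vi.card + 1 ≤ (k + 1) * (Vi.card + 1) := Nat.le_mul_of_pos_left _ k.succ_pos
        omega
    | some v =>
      have hvm : v ∈ Vi \ S := Finset.mem_toList.1 (List.argmax_mem hv)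
      obtain ⟨hvV, hvS⟩ := Finset.mem_sdiff.1 hvm
      refine (post_coverSets F (idx v) v cnt covered S (hidx v).1 (hidx v).2 hcnt hcov).bind ?_
      rintro ⟨cnt', covered'⟩ c ⟨h1, h2, h3⟩
      refine (ih cnt' covered' (insert v S) (Finset.insert_subset hvV hS) h1 h2).mono ?_
      rintro S' c' ⟨g1, g2, g3, g4⟩
      rw [Finset.card_insert_of_notMem hvS] at g2
      refine ⟨g1, fun h => by rw [g2 (by omega)]; omega, fun O hO hOb => ?_, ?_⟩
      · refine (g3 O hO hOb).trans ?_
        rw [pow_succ, mul_assoc]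
        refine mul_le_mul_of_nonneg_left ?_ (pow_nonneg hr0 k)
        rw [coverCount_insert hcov, ← hcnt v]
        have hle : coverCount F O ≤ coverCount F S + b * cnt v := by
          refine (coverCount_le_add (g := cnt v) hcnt hcov fun o ho hoS => ?_).trans ?_
          · exact List.le_of_mem_argmax
              (Finset.mem_toList.2 (Finset.mem_sdiff.2 ⟨hO ho, hoS⟩)) hv
          · exact Nat.add_le_add_left (Nat.mul_le_mul_right _ hOb) _
        have hle' : (coverCount F O : ℝ) - coverCount F S ≤ b * cnt v := by
          have : (coverCount F O : ℝ) ≤ coverCount F S + b * cnt v := by exact_mod_cast hle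
          linarith
        have : ((coverCount F O : ℝ) - coverCount F S) / b ≤ cnt v := by
          rw [div_le_iff₀ (by linarith)]
          linarith
        push_cast
        rw [sub_mul, one_mul, one_div, inv_mul_eq_div]
        linarith
      · have : ∑ u ∈ Vi \ S, (idx u).length =
            (idx v).length + ∑ u ∈ Vi \ insert v S, (idx u).length := by
          rw [← Finset.add_sum_erase _ _ hvm, ← Finset.sdiff_insert]
        simp only at g4 h3
        rw [Nat.succ_mul]
        omega

theorem sum_length_idx_le (Vi : Finset V) (F : List (Finset V)) (idx : V → List ℕ)
    (hidx : IndexSpec F idx) :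
    ∑ v ∈ Vi, (idx v).length ≤ ∑ j ∈ Finset.range F.length, (F.getD j ∅).card := by
  have h (v : V) : (idx v).length =
      ∑ j ∈ Finset.range F.length, if v ∈ F.getD j ∅ then 1 else 0 := by
    rw [← List.toFinset_card_of_nodup (hidx v).1, ← Finset.card_filter]
    congr 1
    ext j
    rw [List.mem_toFinset, (hidx v).2 j, Finset.mem_filter, Finset.mem_range]
  simp only [h]
  rw [Finset.sum_comm]
  refine Finset.sum_le_sum fun j _ => ?_
  rw [← Finset.card_filter, Finset.filter_mem_eq_inter]
  exact Finset.card_le_card Finset.inter_subset_right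

theorem post_buildIndex (F : List (Finset V)) :
    RandCost.Post (F.zipIdx.foldlM
      (fun (st : (V → ℕ) × (V → List ℕ)) (Rj : Finset V × ℕ) => do
        tick (Rj.1.card + 1)
        pure (fun u => if u ∈ Rj.1 then st.1 u + 1 else st.1 u,
          fun u => if u ∈ Rj.1 then Rj.2 :: st.2 u else st.2 u))
      (fun _ => 0, fun _ => [])) fun st k =>
        CountSpec F (fun _ => false) st.1 ∧ IndexSpec F st.2 ∧ k = listSize F := by
  -- Here `i` is the number of sets read so far.
  refine (post_foldlM _ (fun l (st : (V → ℕ) × (V → List ℕ)) k =>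
    ∃ i ≤ F.length, l = F.zipIdx.drop i ∧
      (∀ u, st.1 u = ((Finset.range i).filter fun j => u ∈ F.getD j ∅).card) ∧
      (∀ u, (st.2 u).Nodup ∧ ∀ j, j ∈ st.2 u ↔ j < i ∧ u ∈ F.getD j ∅) ∧
      k = ∑ j ∈ Finset.range i, ((F.getD j ∅).card + 1)) ?_ _ _ 0 ?_).mono ?_
  · rintro ⟨R, j⟩ l ⟨c, x⟩ k ⟨i, -, h2, h3, h4, h5⟩
    simp only at h3 h4
    have hi : i < F.zipIdx.length := by
      by_contra hi
      rw [List.drop_eq_nil_of_le (not_lt.1 hi)] at h2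
      exact List.cons_ne_nil _ _ h2
    rw [List.drop_eq_getElem_cons hi, List.getElem_zipIdx, List.cons.injEq, Prod.mk.injEq,
      zero_add] at h2
    rw [List.length_zipIdx] at hi
    obtain ⟨⟨hR, rfl⟩, rfl⟩ := h2
    replace hR : R = F.getD j ∅ := by rw [hR, List.getD_eq_getElem _ _ hi]
    subst hR
    refine post_tick_bind (post_pure ⟨j + 1, hi, rfl, fun u => ?_, fun u => ?_, ?_⟩)
    · simp only [h3 u, Finset.range_add_one, Finset.filter_insert]
      split_ifs with hu
      · rw [Finset.card_insert_of_notMem (by simp)]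
      · rfl
    · simp only
      split_ifs with hu
      · refine ⟨List.nodup_cons.2 ⟨fun h => ?_, (h4 u).1⟩, fun i => ?_⟩
        · exact absurd (((h4 u).2 j).1 h).1 (lt_irrefl j)
        · rw [List.mem_cons, (h4 u).2 i, Nat.lt_succ_iff_lt_or_eq]
          constructor
          · rintro (rfl | h)
            · exact ⟨Or.inr rfl, hu⟩
            · exact ⟨Or.inl h.1, h.2⟩
          · rintro ⟨h | h, h'⟩
            · exact Or.inr ⟨h, h'⟩
            · exact Or.inl h
      · refine ⟨(h4 u).1, fun i => ?_⟩
        rw [(h4 u).2 i, Nat.lt_succ_iff_lt_or_eq]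
        constructor
        · exact fun h => ⟨Or.inl h.1, h.2⟩
        · rintro ⟨h | rfl, h'⟩
          · exact ⟨h, h'⟩
          · exact absurd h' hu
    · rw [Finset.sum_range_succ, h5, add_zero]
  · exact ⟨0, Nat.zero_le _, rfl, by simp, by simp, by simp⟩
  · rintro ⟨c, x⟩ k ⟨i, h1, h2, h3, h4, h5⟩
    have hi : i = F.length := by
      refine le_antisymm h1 ?_
      simpa using List.drop_eq_nil_iff.1 h2.symm
    subst hi
    refine ⟨fun u => ?_, h4, ?_⟩
    · rw [h3 u]
      simp [uncovered]
    · rw [zero_add] at h5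
      rw [h5, listSize, sum_map_eq_sum_range F ∅]

/-- The three passes over the data are building the index, traversing the index lists, and
decreasing the counters. -/
theorem post_greedy (Vi : Finset V) (F : List (Finset V)) (b : ℕ) (hb : 1 ≤ b)
    (hbV : b ≤ Vi.card) :
    (greedy Vi F b).Post fun S c => S ⊆ Vi ∧ S.card = b ∧
      (∀ O ⊆ Vi, O.card ≤ b → rho b * coverCount F O ≤ coverCount F S) ∧
      c ≤ Vi.card + b * (Vi.card + 1) + 3 * listSize F := by
  refine post_tick_bind ((post_buildIndex F).bind ?_)
  rintro ⟨cnt, idx⟩ c ⟨h1, h2, h3⟩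
  refine (post_greedyLoop Vi F idx h2 b hb b cnt _ ∅ (Finset.empty_subset _) h1 ?_).mono ?_
  · intro j _
    simp
  · rintro S c' ⟨g1, g2, g3, g4⟩
    refine ⟨g1, by simpa using g2 (by simpa using hbV), fun O hO hOb => ?_, ?_⟩
    · have := g3 O hO hOb
      have h0 : coverCount F ∅ = 0 := by simp [coverCount]
      rw [h0, Nat.cast_zero, sub_zero] at this
      rw [rho, sub_mul, one_mul]
      linarith
    · have k1 := sum_length_idx_le Vi F idx h2
      have k2 : ∑ j ∈ uncovered F fun _ => false, (F.getD j ∅).card =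
          ∑ j ∈ Finset.range F.length, (F.getD j ∅).card := by simp [uncovered]
      have k3 := listSize_eq_sum F
      rw [Finset.sdiff_empty] at g4
      omega

end ASM

/-! ### The stopping rule and the sizes of the parameters. -/

namespace ASM

theorem rho_le_one {b : ℕ} (hb : 1 ≤ b) : rho b ≤ 1 := by
  have hb' : (1 : ℝ) ≤ b := by exact_mod_cast hb
  have h : 0 ≤ 1 - 1 / (b : ℝ) := by
    rw [sub_nonneg, div_le_one (by linarith)]
    exact hb'
  have := pow_nonneg h b
  rw [rho]
  linarith

theorem half_le_rho {b : ℕ} (hb : 1 ≤ b) : 1 / 2 ≤ rho b := by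
  have h := Real.one_sub_div_pow_le_exp_neg (n := b) (t := 1) (by exact_mod_cast hb)
  have h' := Real.exp_neg_one_lt_d9
  rw [rho]
  linarith

/-- Put `a = x²` and `Λ = y²`, so that the assumption on `Λ` reads `9x ≤ ey`. The lower bound is at
least `y² - 2xy - x²`, and `ρ` times the upper bound at most `y² + 4xy + 2x²`. They differ by `6xy +
3x² ≤ 9xy ≤ ey²`. Absolute values appear because `a₁` and `a₂` may be negative for `ε` close to `1`.
-/
theorem le_coverLower_div_coverUpper {a a₁ a₂ e ρ Λ : ℝ} (ha : 0 < a) (h₁ : |a₁| ≤ a)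
    (h₂ : |a₂| ≤ a) (he : 0 < e) (he1 : e ≤ 1) (hρ : 1 / 2 ≤ ρ) (hρ1 : ρ ≤ 1)
    (hΛ : 81 * a / e ^ 2 ≤ Λ) :
    ρ * (1 - e) ≤ coverLower a₁ Λ / coverUpper a₂ ρ Λ := by
  rw [abs_le] at h₁ h₂
  obtain ⟨x, hx, rfl⟩ : ∃ x : ℝ, 0 < x ∧ a = x ^ 2 :=
    ⟨√a, Real.sqrt_pos.2 ha, (Real.sq_sqrt ha.le).symm⟩
  have hΛ0 : 0 ≤ Λ := le_trans (by positivity) hΛ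
  obtain ⟨y, hy, rfl⟩ : ∃ y : ℝ, 0 ≤ y ∧ Λ = y ^ 2 :=
    ⟨√Λ, Real.sqrt_nonneg _, (Real.sq_sqrt hΛ0).symm⟩
  have hxy : 9 * x ≤ e * y := by
    rw [div_le_iff₀ (by positivity)] at hΛ
    refine le_of_sq_le_sq ?_ (by positivity)
    nlinarith
  have hxy1 : 9 * x ≤ y := hxy.trans (by nlinarith)
  have hρ0 : 0 < ρ := by linarith
  have hyρ : y ^ 2 ≤ y ^ 2 / ρ := by
    rw [le_div_iff₀ hρ0]
    nlinarith [sq_nonneg y]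
  have hyρ2 : y ^ 2 / ρ ≤ 2 * y ^ 2 := by
    rw [div_le_iff₀ hρ0]
    nlinarith [sq_nonneg y]
  have hlow : y ^ 2 - 2 * x * y - x ^ 2 ≤ coverLower a₁ (y ^ 2) := by
    have hP : √(y ^ 2 - x ^ 2) ≤ √(y ^ 2 + 2 * a₁ / 9) := Real.sqrt_le_sqrt (by linarith)
    have hA : √(a₁ / 2) ≤ x := Real.sqrt_le_iff.2 ⟨hx.le, by linarith⟩
    have hQ : x ≤ √(y ^ 2 - x ^ 2) := Real.le_sqrt_of_sq_le (by nlinarith)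
    have hQy : √(y ^ 2 - x ^ 2) ≤ y := Real.sqrt_le_iff.2 ⟨hy, by nlinarith⟩
    have hQ2 : √(y ^ 2 - x ^ 2) ^ 2 = y ^ 2 - x ^ 2 := Real.sq_sqrt (by nlinarith)
    have hsq : (√(y ^ 2 - x ^ 2) - x) ^ 2 ≤ (√(y ^ 2 + 2 * a₁ / 9) - √(a₁ / 2)) ^ 2 :=
      pow_le_pow_left₀ (by linarith) (by linarith) 2
    unfold coverLower
    nlinarith
  have hup : ρ * coverUpper a₂ ρ (y ^ 2) ≤ y ^ 2 + 2 * x ^ 2 + 4 * x * y := by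
    have hA : √(a₂ / 2) ≤ x := Real.sqrt_le_iff.2 ⟨hx.le, by linarith⟩
    have hR : √(y ^ 2 / ρ + a₂ / 2) ≤ √(y ^ 2 / ρ + x ^ 2) := Real.sqrt_le_sqrt (by linarith)
    have hRy : √(y ^ 2 / ρ + x ^ 2) ≤ 2 * y := Real.sqrt_le_iff.2 ⟨by linarith, by nlinarith⟩
    have hR2 : √(y ^ 2 / ρ + x ^ 2) ^ 2 = y ^ 2 / ρ + x ^ 2 := Real.sq_sqrt (by positivity)
    have hsq : coverUpper a₂ ρ (y ^ 2) ≤ (√(y ^ 2 / ρ + x ^ 2) + x) ^ 2 :=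
      pow_le_pow_left₀ (by positivity) (by linarith) 2
    have h1 : coverUpper a₂ ρ (y ^ 2) ≤ y ^ 2 / ρ + (2 * x ^ 2 + 4 * x * y) := by nlinarith
    calc ρ * coverUpper a₂ ρ (y ^ 2)
        ≤ ρ * (y ^ 2 / ρ + (2 * x ^ 2 + 4 * x * y)) := mul_le_mul_of_nonneg_left h1 hρ0.le
      _ = y ^ 2 + ρ * (2 * x ^ 2 + 4 * x * y) := by
          rw [mul_add, mul_div_cancel₀ _ hρ0.ne']
      _ ≤ _ := by
          have : 0 ≤ 2 * x ^ 2 + 4 * x * y := by positivity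
          nlinarith
  have hpos : 0 < coverUpper a₂ ρ (y ^ 2) := by
    have : 0 < √(y ^ 2 / ρ + a₂ / 2) := Real.sqrt_pos.2 (by nlinarith)
    have := Real.sqrt_nonneg (a₂ / 2)
    unfold coverUpper
    positivity
  rw [le_div_iff₀ hpos]
  calc ρ * (1 - e) * coverUpper a₂ ρ (y ^ 2)
      = (1 - e) * (ρ * coverUpper a₂ ρ (y ^ 2)) := by ring
    _ ≤ (1 - e) * (y ^ 2 + 2 * x ^ 2 + 4 * x * y) :=
        mul_le_mul_of_nonneg_left hup (by linarith)
    _ ≤ y ^ 2 - 2 * x * y - x ^ 2 := by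
        have h1 : 9 * x * y ≤ e * y * y := mul_le_mul_of_nonneg_right hxy hy
        have h2 : 0 ≤ e * (2 * x ^ 2 + 4 * x * y) := by positivity
        nlinarith
    _ ≤ _ := hlow

/-- The ranges of the parameters of a call of TRIM-B; `N` bounds the number `ni` of nodes. -/
structure ParamRange (c N ni ηi b : ℕ) (ε : ℝ) : Prop where
  two_le : 2 ≤ N
  ni_le : ni ≤ N
  one_le_b : 1 ≤ b
  b_le : b ≤ ni
  one_le_eta : 1 ≤ ηi
  eta_le : ηi ≤ ni
  eps_pos : 0 < ε
  eps_lt : ε < 1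
  eps_ge : 1 / (N : ℝ) ^ c ≤ ε

namespace ParamRange

variable {c N ni ηi b : ℕ} {ε : ℝ}

/-- If `thetaMax` vanishes, the conventions for division by zero and `logb 2 0 = 0` give a single
iteration. Assuming two iterations thus excludes the degenerate case, in which no stopping test
takes place. -/
theorem thetaMax_ne_zero (hT : 2 ≤ maxIter ε ni ηi b) : thetaMax ε ni ηi b ≠ 0 := by
  intro h0
  simp [maxIter, h0] at hT

variable (h : ParamRange c N ni ηi b ε)

include h

theorem half_le_log : 1 / 2 ≤ Real.log N := by
  have h1 := Real.log_two_gt_d9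
  have h2 : Real.log 2 ≤ Real.log N := Real.log_le_log (by norm_num) (by exact_mod_cast h.two_le)
  linarith

theorem log_two_le : Real.log 2 ≤ Real.log N :=
  Real.log_le_log (by norm_num) (by exact_mod_cast h.two_le)

theorem cast_pos : (0 : ℝ) < N := by
  have := h.two_le
  exact_mod_cast (by omega : 0 < N)

theorem ni_pos : (0 : ℝ) < ni := by
  have := h.one_le_b.trans h.b_le
  exact_mod_cast (by omega : 0 < ni)

theorem one_le_cast_b : (1 : ℝ) ≤ b := by exact_mod_cast h.one_le_b

theorem inv_eps_le : 1 / ε ≤ (N : ℝ) ^ c := by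
  have := h.eps_ge
  have h1 := h.eps_pos
  have h2 : 0 < (N : ℝ) ^ c := pow_pos h.cast_pos c
  rw [div_le_iff₀ h2] at this
  rw [div_le_iff₀ h1]
  linarith

theorem half_le_epsHat : ε / 2 ≤ epsHat ε := by
  have h1 := h.eps_pos
  have h2 := h.eps_lt
  rw [epsHat, le_div_iff₀ (by linarith)]
  nlinarith

theorem epsHat_pos : 0 < epsHat ε := by
  have h1 := h.eps_pos
  have := h.half_le_epsHat
  linarith

theorem epsHat_le_one : epsHat ε ≤ 1 := by
  have h2 := h.eps_lt
  rw [epsHat, div_le_one (by linarith)]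
  linarith

theorem delta_pos : 0 < delta ε ηi := by
  have h1 := h.eps_pos
  have h2 := h.eps_lt
  have h3 : (0 : ℝ) < ηi := by exact_mod_cast h.one_le_eta
  have h4 : 0 < 1 - 1 / Real.exp 1 := by
    rw [sub_pos, div_lt_one (Real.exp_pos 1)]
    exact Real.one_lt_exp_iff.2 one_pos
  have h5 : 0 < 1 - ε := by linarith
  unfold delta
  positivity

theorem log_six_div_delta_le : Real.log (6 / delta ε ηi) ≤ (c + 11) * Real.log N := by
  have h1 := h.eps_pos
  have h2 := h.eps_lt
  have h3 : (0 : ℝ) < ηi := by exact_mod_cast h.one_le_eta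
  have hηN : (ηi : ℝ) ≤ N := by exact_mod_cast h.eta_le.trans h.ni_le
  have hN := h.cast_pos
  have h4 : 1 - 1 / Real.exp 1 ≤ 1 := by
    have : 0 ≤ 1 / Real.exp 1 := by positivity
    linarith
  have h4' : 0 ≤ 1 - 1 / Real.exp 1 := by
    rw [sub_nonneg, div_le_one (Real.exp_pos 1)]
    exact Real.one_le_exp zero_le_one
  -- A power of two above `600`, so that its logarithm is absorbed through `log 2 ≤ log N`.
  have hle : 6 / delta ε ηi ≤ 2 ^ 10 * (N * N ^ c) := by
    have h5 : (1 - 1 / Real.exp 1) * (1 - ε) ≤ 1 := mul_le_one₀ h4 (by linarith) (by linarith)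
    have h5' : 0 ≤ (1 - 1 / Real.exp 1) * (1 - ε) := mul_nonneg h4' (by linarith)
    calc 6 / delta ε ηi
        = 600 * (((1 - 1 / Real.exp 1) * (1 - ε)) * (ηi * (1 / ε))) := by
          rw [delta, div_div_eq_mul_div]
          ring
      _ ≤ 600 * (1 * (N * N ^ c)) := by
          have := h.inv_eps_le
          gcongr
      _ ≤ _ := by
          have : 0 ≤ (N : ℝ) * N ^ c := by positivity
          linarith
  calc Real.log (6 / delta ε ηi)
      ≤ Real.log (2 ^ 10 * (N * N ^ c)) :=
        Real.log_le_log (div_pos (by norm_num) h.delta_pos) hle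
    _ = 10 * Real.log 2 + (1 + c) * Real.log N := by
        rw [Real.log_mul (by positivity) (by positivity),
          Real.log_mul (by positivity) (by positivity), Real.log_pow, Real.log_pow]
        push_cast
        ring
    _ ≤ _ := by
        have := h.log_two_le
        linarith

theorem log_choose_nonneg : 0 ≤ Real.log (ni.choose b) :=
  Real.log_nonneg (by exact_mod_cast Nat.choose_pos h.b_le)

theorem log_choose_le : Real.log (ni.choose b) ≤ b * Real.log N := by
  rw [← Real.log_pow]
  refine Real.log_le_log (by exact_mod_cast Nat.choose_pos h.b_le) ?_
  exact_mod_cast (Nat.choose_le_pow ni b).trans (Nat.pow_le_pow_left h.ni_le b)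

theorem thetaInit_eq : thetaInit ε ni ηi b = 2 * (√(Real.log (6 / delta ε ηi))
    + √((Real.log (ni.choose b) + Real.log (6 / delta ε ηi)) / rho b)) ^ 2 := by
  have h1 := h.ni_pos
  have h2 := h.one_le_cast_b
  have h3 := h.epsHat_pos
  rw [thetaInit, thetaMax]
  field_simp

theorem thetaInit_le : thetaInit ε ni ηi b ≤ (12 * c + 140) * (b * Real.log N) := by
  have hL := h.half_le_log
  have hb := h.one_le_cast_b
  have hx := h.log_six_div_delta_le
  have hy := h.log_choose_le
  have hρ := half_le_rho h.one_le_b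
  have hbL : Real.log N ≤ b * Real.log N := by nlinarith
  have hcL : 0 ≤ ((c : ℝ) + 11) * Real.log N := by positivity
  have hcL' : ((c : ℝ) + 11) * Real.log N ≤ (c + 11) * (b * Real.log N) := by gcongr
  have h1 : √(Real.log (6 / delta ε ηi)) ^ 2 ≤ (c + 11) * (b * Real.log N) := by
    rw [Real.sq_sqrt']
    exact max_le (hx.trans hcL') (hcL.trans hcL')
  have h2 : √((Real.log (ni.choose b) + Real.log (6 / delta ε ηi)) / rho b) ^ 2 ≤
      2 * ((c + 12) * (b * Real.log N)) := by
    rw [Real.sq_sqrt']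
    have h0 : 0 ≤ (c + 12) * (b * Real.log N) := by positivity
    refine max_le ?_ (by positivity)
    rw [div_le_iff₀ (by linarith)]
    nlinarith
  rw [h.thetaInit_eq]
  -- The constant is `2 * 2 * ((c + 11) + 2 * (c + 12)) = 12 * c + 140`.
  have := add_sq_le (a := √(Real.log (6 / delta ε ηi)))
    (b := √((Real.log (ni.choose b) + Real.log (6 / delta ε ηi)) / rho b))
  linarith

/-- Unless `thetaMax` is zero, the quotient is `ni / (b * epsHat ε ^ 2)`, which is polynomial in `N`
because `1 / ε ≤ N ^ c`. -/
theorem maxIter_le : (maxIter ε ni ηi b : ℝ) ≤ (4 * c + 10) * Real.log N := by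
  have hL := h.half_le_log
  have hN := h.cast_pos
  have hlog : Real.logb 2 (thetaMax ε ni ηi b / thetaInit ε ni ηi b) ≤
      (4 * c + 6) * Real.log N := by
    have h1 := h.ni_pos
    have h2 := h.one_le_cast_b
    have h3 := h.epsHat_pos
    have h4 := h.eps_pos
    by_cases h0 : thetaMax ε ni ηi b = 0
    · rw [h0, zero_div, Real.logb_zero]
      positivity
    · have heq : thetaMax ε ni ηi b / thetaInit ε ni ηi b = ni / (b * epsHat ε ^ 2) := by
        rw [thetaInit]
        field_simp
      have hle : ni / (b * epsHat ε ^ 2) ≤ 2 ^ 2 * (N * N ^ (2 * c)) := by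
        calc ni / (b * epsHat ε ^ 2) ≤ N / (1 * (ε / 2) ^ 2) := by
              have := h.ni_le
              have := h.half_le_epsHat
              gcongr
          _ = 2 ^ 2 * (N * (1 / ε) ^ 2) := by
              field_simp
          _ ≤ 2 ^ 2 * (N * (N ^ c) ^ 2) := by
              have := h.inv_eps_le
              gcongr
          _ = _ := by ring
      have hlog2 : Real.log (ni / (b * epsHat ε ^ 2)) ≤ (2 * c + 3) * Real.log N := by
        refine (Real.log_le_log (by positivity) hle).trans ?_
        rw [Real.log_mul (by positivity) (by positivity),
          Real.log_mul (by positivity) (by positivity), Real.log_pow, Real.log_pow]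
        have := h.log_two_le
        push_cast
        linarith
      have hl2 := Real.log_two_gt_d9
      rw [heq, Real.logb, div_le_iff₀ (by linarith)]
      have h0 : 0 ≤ (2 * (c : ℝ) + 3) * Real.log N := by positivity
      nlinarith
  have hceil : (⌈Real.logb 2 (thetaMax ε ni ηi b / thetaInit ε ni ηi b)⌉₊ : ℝ) ≤
      (4 * c + 6) * Real.log N + 1 := by
    refine (Nat.cast_le.2 (Nat.ceil_mono hlog)).trans (Nat.ceil_lt_add_one ?_).le
    positivity
  rw [maxIter]
  push_cast
  linarith

theorem thetaInit_pos (hT : 2 ≤ maxIter ε ni ηi b) : 0 < thetaInit ε ni ηi b := by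
  have h0 := thetaMax_ne_zero hT
  have h1 := h.ni_pos
  have h2 := h.one_le_cast_b
  have h3 := h.epsHat_pos
  refine lt_of_le_of_ne ?_ (Ne.symm ?_)
  · rw [h.thetaInit_eq]
    positivity
  · rw [thetaInit]
    have : (b : ℝ) ≠ 0 := by positivity
    positivity

/-- Otherwise both radicands in `thetaInit` would be nonpositive, the square roots would be zero,
and so would `thetaInit`. -/
theorem neg_log_le (hT : 2 ≤ maxIter ε ni ηi b) :
    -(b * Real.log N) ≤ Real.log (6 / delta ε ηi) := by
  by_contra hlt
  have h1 := h.log_choose_le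
  have h2 := h.log_choose_nonneg
  have h3 := h.thetaInit_pos hT
  have h4 := half_le_rho h.one_le_b
  have h5 : 0 ≤ b * Real.log N := h2.trans h1
  rw [h.thetaInit_eq, Real.sqrt_eq_zero_of_nonpos (by linarith),
    Real.sqrt_eq_zero_of_nonpos (div_nonpos_of_nonpos_of_nonneg (by linarith) (by linarith))] at h3
  norm_num at h3

theorem aTwo_eq : aTwo ε ni ηi b =
    Real.log (maxIter ε ni ηi b) + Real.log (6 / delta ε ηi) - Real.log 2 := by
  have h1 := h.delta_pos
  have h2 : (0 : ℝ) < maxIter ε ni ηi b := by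
    rw [maxIter]
    positivity
  rw [aTwo, ← Real.log_mul (by positivity) (by positivity),
    ← Real.log_div (by positivity) (by norm_num)]
  congr 1
  ring

theorem le_aTwo (hT : 2 ≤ maxIter ε ni ηi b) : -(2 * (b * Real.log N)) ≤ aTwo ε ni ηi b := by
  have h1 := h.neg_log_le hT
  have h2 := h.log_two_le
  have h3 := h.one_le_cast_b
  have h4 := h.half_le_log
  have h5 : 0 ≤ Real.log (maxIter ε ni ηi b) := Real.log_natCast_nonneg _
  rw [h.aTwo_eq]
  nlinarith

theorem aTwo_le : aTwo ε ni ηi b ≤ (5 * c + 21) * (b * Real.log N) := by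
  have h1 := h.log_six_div_delta_le
  have h2 := h.maxIter_le
  have h3 := h.one_le_cast_b
  have h4 := h.half_le_log
  -- The crude `log T ≤ T` suffices, as `T` itself is `O(log N)`.
  have h5 := Real.log_le_self (Nat.cast_nonneg (maxIter ε ni ηi b) (α := ℝ))
  have h6 : Real.log N ≤ b * Real.log N := by nlinarith
  have h7 : (5 * (c : ℝ) + 21) * Real.log N ≤ (5 * c + 21) * (b * Real.log N) := by gcongr
  have h8 := Real.log_two_gt_d9
  rw [h.aTwo_eq]
  linarith

/-- The factor `324 = 81 * 4` comes from `epsHat ε ≥ ε / 2`, and `5 * c + 22` exceeds the constant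
for `aTwo` by one to make room for the binomial term of `aOne`. -/
theorem stop_of_le (hT : 2 ≤ maxIter ε ni ηi b) {Λ : ℝ}
    (hΛ : 324 * ((5 * c + 22) * (b * Real.log N)) / ε ^ 2 ≤ Λ) :
    rho b * (1 - epsHat ε) ≤
      coverLower (aOne ε ni ηi b) Λ / coverUpper (aTwo ε ni ηi b) (rho b) Λ := by
  have h1 := h.le_aTwo hT
  have h2 := h.aTwo_le
  have h3 := h.one_le_cast_b
  have h4 := h.half_le_log
  have h5 := h.log_choose_le
  have h6 := h.log_choose_nonneg
  have h7 := h.eps_pos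
  have h8 := h.half_le_epsHat
  have hbL : 0 < b * Real.log N := by positivity
  have ha₁ : aOne ε ni ηi b = aTwo ε ni ηi b + Real.log (ni.choose b) := rfl
  have hcb : 0 ≤ (c : ℝ) * (b * Real.log N) := by positivity
  refine le_coverLower_div_coverUpper (a := (5 * c + 22) * (b * Real.log N)) (by positivity)
    (abs_le.2 ⟨?_, ?_⟩) (abs_le.2 ⟨?_, ?_⟩) h.epsHat_pos h.epsHat_le_one (half_le_rho h.one_le_b)
    (rho_le_one h.one_le_b) (le_trans ?_ hΛ)
  · linarith
  · linarith
  · linarith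
  · linarith
  · calc 81 * ((5 * c + 22) * (b * Real.log N)) / epsHat ε ^ 2
        ≤ 81 * ((5 * c + 22) * (b * Real.log N)) / (ε / 2) ^ 2 := by gcongr
      _ = _ := by
          field_simp
          ring

end ParamRange

end ASM

/-! ### One iteration of TRIM-B, the tail bound, and the doubling potential. -/

namespace ASM
variable {V : Type} [DecidableEq V]

open RandCost

/-- A bound on the steps of an iteration of TRIM-B, apart from those for the mRR-sets. -/
def iterCost (Vi : Finset V) (b : ℕ) : ℕ := Vi.card + b * (Vi.card + 1) + 1

theorem expectedCost_trimBLoop_zero (G : ProbGraph V) (Vi : Finset V) (ηi b : ℕ) (ε : ℝ)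
    (hb : 1 ≤ b) (hbV : b ≤ Vi.card) (F : List (Finset V)) :
    (trimBLoop G Vi ηi b ε 0 F).expectedCost ≤ (iterCost Vi b + 4 * listSize F : ℕ) := by
  refine expectedCost_le_of_post ((post_greedy Vi F b hb hbV).mono ?_)
  rintro S k ⟨-, -, -, h⟩
  rw [iterCost]
  omega

/-- If `O` hits at least `M` sets, greedy hits at least `rho b * M ≥ M / 2` and the loop stops. The
event of continuing is thereby replaced by one about a fixed `O`, so no union bound over the
data-dependent greedy set is needed. -/
theorem expectedCost_trimBLoop_succ (G : ProbGraph V) (Vi : Finset V) (ηi b : ℕ) (ε : ℝ)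
    (hb : 1 ≤ b) (hbV : b ≤ Vi.card) (O : Finset V) (hO : O ⊆ Vi) (hOb : O.card ≤ b) (M : ℕ)
    (hM : ∀ Λ : ℝ, (M : ℝ) / 2 ≤ Λ → rho b * (1 - epsHat ε) ≤
      coverLower (aOne ε Vi.card ηi b) Λ / coverUpper (aTwo ε Vi.card ηi b) (rho b) Λ)
    (k : ℕ) (F : List (Finset V)) :
    (trimBLoop G Vi ηi b ε (k + 1) F).expectedCost ≤ (iterCost Vi b + 4 * listSize F : ℕ) +
      if coverCount F O < M then
        F.length * (mrrSet G Vi ηi).expectedCost + (mrrSets G Vi ηi F.length).mean fun F' =>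
          (trimBLoop G Vi ηi b ε k (F ++ F')).expectedCost
      else 0 := by
  set Z : ℝ≥0∞ := if coverCount F O < M then
        F.length * (mrrSet G Vi ηi).expectedCost + (mrrSets G Vi ηi F.length).mean fun F' =>
          (trimBLoop G Vi ηi b ε k (F ++ F')).expectedCost
      else 0 with hZ
  rw [trimBLoop, expectedCost_bind]
  have h1 : (greedy Vi F b).expectedCost ≤
      (Vi.card + b * (Vi.card + 1) + 3 * listSize F : ℕ) :=
    expectedCost_le_of_post ((post_greedy Vi F b hb hbV).mono fun _ _ h => h.2.2.2)
  have h2 : ((greedy Vi F b).mean fun S => (do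
      let Λ ← coverage F S
      tick 1
      if rho b * (1 - epsHat ε) ≤
          coverLower (aOne ε Vi.card ηi b) Λ / coverUpper (aTwo ε Vi.card ηi b) (rho b) Λ then
        pure S
      else do
        let F' ← mrrSets G Vi ηi F.length
        trimBLoop G Vi ηi b ε k (F ++ F') : RandCost (Finset V)).expectedCost) ≤
      (listSize F + 1 : ℕ) + Z := by
    refine mean_le_of_post (post_greedy Vi F b hb hbV) ?_
    rintro S _ ⟨-, -, hS, -⟩
    rw [expectedCost_bind, Nat.cast_add, add_assoc]
    refine add_le_add (expectedCost_le_of_post ((post_coverage F S).mono fun _ _ h => h.2.le))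
      (mean_le_of_post (post_coverage F S) ?_)
    rintro Λ _ ⟨rfl, -⟩
    rw [expectedCost_tick_bind]
    refine add_le_add_right ?_ _
    split_ifs with hst
    · rw [expectedCost_pure]
      exact zero_le
    · have hlt : coverCount F O < M := by
        by_contra hge
        refine hst (hM _ ?_)
        have g1 : (M : ℝ) ≤ coverCount F O := by exact_mod_cast not_lt.1 hge
        have g2 := hS O hO hOb
        have g3 := half_le_rho hb
        nlinarith
      rw [hZ, if_pos hlt, expectedCost_bind, expectedCost_mrrSets]
  refine (add_le_add h1 h2).trans_eq ?_
  rw [← add_assoc, ← Nat.cast_add]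
  congr 2
  rw [iterCost]
  omega

theorem mean_mrrSets_prod (G : ProbGraph V) (Vi : Finset V) (ηi N : ℕ) (g : Finset V → ℝ≥0∞) :
    ((mrrSets G Vi ηi N).mean fun F => (F.map g).prod) = (mrrSet G Vi ηi).mean g ^ N := by
  induction N with
  | zero => simp [mrrSets, mean_pure]
  | succ N ih =>
    simp only [mrrSets, mean_bind, mean_pure, List.map_cons, List.prod_cons, mean_const_mul, ih,
      mean_mul_const]
    rw [pow_succ']

theorem mean_mrrSets_sum (G : ProbGraph V) (Vi : Finset V) (ηi N : ℕ) (w : Finset V → ℝ≥0∞) :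
    ((mrrSets G Vi ηi N).mean fun F => (F.map w).sum) = N * (mrrSet G Vi ηi).mean w := by
  induction N with
  | zero => simp [mrrSets, mean_pure]
  | succ N ih =>
    simp only [mrrSets, mean_bind, mean_pure, List.map_cons, List.sum_cons, mean_add, ih,
      mean_const]
    push_cast
    ring

/-- By independence, the mean is `N * E[w g] * E[g] ^ (N - 1)`. Here `g ≤ 1` removes `g` from the
first expectation, and `1 ≤ 2 * E[g]` restores the exponent `N`. -/
theorem mean_mrrSets_sum_mul_prod_le (G : ProbGraph V) (Vi : Finset V) (ηi N : ℕ)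
    (w g : Finset V → ℝ≥0∞) (hg : ∀ R, g R ≤ 1) (hγ : 1 ≤ 2 * (mrrSet G Vi ηi).mean g) :
    ((mrrSets G Vi ηi N).mean fun F => (F.map w).sum * (F.map g).prod) ≤
      N * (mrrSet G Vi ηi).mean w * (2 * (mrrSet G Vi ηi).mean g ^ N) := by
  induction N with
  | zero => simp [mrrSets, mean_pure]
  | succ N ih =>
    set γ := (mrrSet G Vi ηi).mean g
    set ω := (mrrSet G Vi ηi).mean w
    have hstep (R : Finset V) (F : List (Finset V)) :
        ((R :: F).map w).sum * ((R :: F).map g).prod =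
          (w R * g R) * (F.map g).prod + g R * ((F.map w).sum * (F.map g).prod) := by
      simp only [List.map_cons, List.sum_cons, List.prod_cons]
      ring
    simp only [mrrSets, mean_bind, mean_pure, hstep, mean_add, mean_const_mul, mean_mul_const,
      mean_mrrSets_prod]
    have h1 : (mrrSet G Vi ηi).mean (fun R => w R * g R) ≤ ω :=
      mean_mono _ fun R => mul_le_of_le_one_right' (hg R)
    calc _ ≤ ω * γ ^ N * (2 * γ) + γ * (N * ω * (2 * γ ^ N)) :=
          add_le_add ((mul_le_mul_left h1 _).trans (le_mul_of_one_le_right zero_le hγ))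
            (mul_le_mul_right ih _)
      _ = _ := by
          push_cast
          ring

/-- The weight `1/2` for the sets that intersect `O`, and `1` for the others. -/
noncomputable def hitWeight (O R : Finset V) : ℝ≥0∞ := if (R ∩ O).Nonempty then 2⁻¹ else 1

theorem hitWeight_le_one (O R : Finset V) : hitWeight O R ≤ 1 := by
  rw [hitWeight]
  split_ifs
  · exact ENNReal.inv_le_one.2 one_le_two
  · exact le_rfl

/-- The probability that a random mRR-set intersects `O`. -/
noncomputable def hitProb (G : ProbGraph V) (Vi : Finset V) (ηi : ℕ) (O : Finset V) : ℝ≥0∞ :=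
  (mrrSet G Vi ηi).mean fun R => if (R ∩ O).Nonempty then 1 else 0

theorem hitProb_le_one (G : ProbGraph V) (Vi : Finset V) (ηi : ℕ) (O : Finset V) :
    hitProb G Vi ηi O ≤ 1 := by
  refine (mean_mono _ fun R => ?_).trans_eq ((mrrSet G Vi ηi).mean_const 1)
  split_ifs <;> simp

theorem mean_hitWeight (G : ProbGraph V) (Vi : Finset V) (ηi : ℕ) (O : Finset V) :
    (mrrSet G Vi ηi).mean (hitWeight O) =
      ENNReal.ofReal (1 - (hitProb G Vi ηi O).toReal / 2) := by
  have hp := hitProb_le_one G Vi ηi O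
  have hfin : hitProb G Vi ηi O ≠ ∞ := ne_top_of_le_ne_top ENNReal.one_ne_top hp
  have hp' : (hitProb G Vi ηi O).toReal ≤ 1 := ENNReal.toReal_le_of_le_ofReal zero_le_one (by simpa)
  have h : (mrrSet G Vi ηi).mean (hitWeight O) + 2⁻¹ * hitProb G Vi ηi O = 1 := by
    rw [hitProb, ← mean_const_mul, ← mean_add]
    refine Eq.trans ?_ ((mrrSet G Vi ηi).mean_const 1)
    congr 1
    funext R
    rw [hitWeight]
    split_ifs
    · rw [mul_one, ENNReal.inv_two_add_inv_two]
    · rw [mul_zero, add_zero]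
  have h2 : 2⁻¹ * hitProb G Vi ηi O = ENNReal.ofReal ((hitProb G Vi ηi O).toReal / 2) := by
    rw [div_eq_inv_mul, ENNReal.ofReal_mul (by norm_num), ENNReal.ofReal_toReal hfin,
      ENNReal.ofReal_inv_of_pos two_pos, ENNReal.ofReal_ofNat]
  rw [h2] at h
  rw [ENNReal.ofReal_sub _ (by positivity), ENNReal.ofReal_one]
  exact ENNReal.eq_sub_of_add_eq ENNReal.ofReal_ne_top h

theorem prod_hitWeight (F : List (Finset V)) (O : Finset V) :
    (F.map (hitWeight O)).prod = 2⁻¹ ^ coverCount F O := by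
  induction F with
  | nil => simp [coverCount]
  | cons R F ih =>
    have h : coverCount (R :: F) O = (if (R ∩ O).Nonempty then 1 else 0) + coverCount F O := by
      rw [coverCount, List.map_cons, List.sum_cons, coverCount]
    rw [List.map_cons, List.prod_cons, ih, h, pow_add, hitWeight]
    split_ifs <;> simp

/-- A Chernoff bound with a weight: the indicator of fewer than `M` hits is at most `2 ^ M * 2⁻¹ ^
hits`, which is a product over the sets. The alternative `1` in the minimum comes from dropping the
indicator. -/
theorem mean_sum_of_coverCount_lt_le (G : ProbGraph V) (Vi : Finset V) (ηi N M : ℕ)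
    (O : Finset V) (w : Finset V → ℝ≥0∞) :
    ((mrrSets G Vi ηi N).mean fun F => if coverCount F O < M then (F.map w).sum else 0) ≤
      (mrrSet G Vi ηi).mean w *
        (N * min 1 (2 ^ (M + 1) * (mrrSet G Vi ηi).mean (hitWeight O) ^ N)) := by
  have hγ : 1 ≤ 2 * (mrrSet G Vi ηi).mean (hitWeight O) := by
    rw [← mean_const_mul]
    refine ((mrrSet G Vi ηi).mean_const 1).symm.trans_le (mean_mono _ fun R => ?_)
    rw [hitWeight]
    split_ifs
    · rw [ENNReal.mul_inv_cancel two_ne_zero ENNReal.ofNat_ne_top]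
    · rw [mul_one]
      exact one_le_two
  rw [← mul_assoc]
  rcases min_choice 1 (2 ^ (M + 1) * (mrrSet G Vi ηi).mean (hitWeight O) ^ N) with h | h
  · rw [h, mul_one]
    refine (mean_mono (g := fun F => (F.map w).sum) _ fun F => ?_).trans_eq
      ((mean_mrrSets_sum G Vi ηi N w).trans (mul_comm _ _))
    split_ifs
    · exact le_rfl
    · exact zero_le
  · rw [h]
    calc _ ≤ (mrrSets G Vi ηi N).mean fun F =>
          2 ^ M * ((F.map w).sum * (F.map (hitWeight O)).prod) := by
          refine mean_mono _ fun F => ?_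
          split_ifs with h
          · rw [prod_hitWeight, mul_left_comm]
            refine le_mul_of_one_le_right zero_le ?_
            rw [← ENNReal.inv_pow, ← div_eq_mul_inv,
              ENNReal.le_div_iff_mul_le (Or.inl (by simp)) (Or.inl (by simp)), one_mul]
            exact pow_le_pow_right₀ one_le_two h.le
          · exact zero_le
      _ ≤ 2 ^ M * (N * (mrrSet G Vi ηi).mean w *
          (2 * (mrrSet G Vi ηi).mean (hitWeight O) ^ N)) := by
          rw [mean_const_mul]
          exact mul_le_mul_right
            (mean_mrrSets_sum_mul_prod_le G Vi ηi N w _ (hitWeight_le_one O) hγ) _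
      _ = _ := by ring

/-- A bound on `∑ t, min (2 ^ t * x) (m ^ 2 / (2 ^ t * x))`. -/
noncomputable def doublingPotential (m x : ℝ) : ℝ := if x < m then 4 * m - x else 2 * m ^ 2 / x

theorem doublingPotential_nonneg {m x : ℝ} (hm : 0 < m) (hx : 0 < x) :
    0 ≤ doublingPotential m x := by
  rw [doublingPotential]
  split_ifs with h
  · linarith
  · positivity

theorem doublingPotential_le {m x : ℝ} (hm : 0 < m) (hx : 0 < x) :
    doublingPotential m x ≤ 4 * m := by
  rw [doublingPotential]
  split_ifs with h
  · linarith
  · rw [div_le_iff₀ hx]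
    nlinarith

/-- The telescoping step: below `m` the terms grow geometrically and the potential pays `x`; above
`m` they decay geometrically and it pays `m² / x`. -/
theorem min_add_doublingPotential_le {m x : ℝ} (hm : 0 < m) (hx : 0 < x) :
    min x (m ^ 2 / x) + doublingPotential m (2 * x) ≤ doublingPotential m x := by
  rw [doublingPotential, doublingPotential]
  by_cases h : x < m
  · rw [if_pos h]
    have h1 := min_le_left x (m ^ 2 / x)
    split_ifs with h2
    · linarith
    · have h3 : 2 * m ^ 2 / (2 * x) ≤ 4 * m - 2 * x := by
        rw [div_le_iff₀ (by positivity)]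
        nlinarith
      linarith
  · rw [if_neg h, if_neg (by linarith)]
    have h1 := min_le_right x (m ^ 2 / x)
    have h2 : 2 * m ^ 2 / (2 * x) = m ^ 2 / x := by field_simp
    have h3 : 2 * m ^ 2 / x = m ^ 2 / x + m ^ 2 / x := by ring
    linarith

/-- For `N p < 4 M` the trivial bound `N` suffices. Otherwise `y = N p / 4` is at least `M`, so `2 ^
M * (1 - p / 2) ^ N ≤ exp (y - 2 y)`, and `exp (-y) ≤ 2 / y²` gives the inverse-square decay in `N`.
-/
theorem two_pow_mul_pow_le {p : ℝ} (hp : 0 < p) (hp1 : p ≤ 1) {M N : ℕ} (hM : 1 ≤ M)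
    (hN : 1 ≤ N) :
    (N : ℝ) * min 1 (2 ^ (M + 1) * (1 - p / 2) ^ N) ≤
      4 * min (N : ℝ) ((4 * M / p) ^ 2 / N) := by
  have hM' : (1 : ℝ) ≤ M := by exact_mod_cast hM
  have hN' : (0 : ℝ) < N := by exact_mod_cast hN
  have h0 : 0 ≤ 1 - p / 2 := by linarith
  rw [mul_min_of_nonneg _ _ (by norm_num : (0 : ℝ) ≤ 4)]
  have hle : (N : ℝ) * min 1 (2 ^ (M + 1) * (1 - p / 2) ^ N) ≤ N :=
    mul_le_of_le_one_right hN'.le (min_le_left _ _)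
  refine le_min (by linarith) ?_
  rw [← mul_div_assoc, le_div_iff₀ hN']
  by_cases hlt : (N : ℝ) * p < 4 * M
  · have h1 : (N : ℝ) ≤ 4 * M / p := by
      rw [le_div_iff₀ hp]
      exact hlt.le
    have h2 : (N : ℝ) ^ 2 ≤ (4 * M / p) ^ 2 := pow_le_pow_left₀ hN'.le h1 2
    nlinarith
  · rw [not_lt] at hlt
    set y : ℝ := N * p / 4 with hy
    have hyM : (M : ℝ) ≤ y := by
      rw [hy]
      linarith
    have hy0 : 0 < y := by linarith
    have h1 : (1 - p / 2) ^ N ≤ Real.exp (-(2 * y)) := by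
      calc (1 - p / 2) ^ N ≤ Real.exp (-(p / 2)) ^ N :=
            pow_le_pow_left₀ h0 (Real.one_sub_le_exp_neg _) N
        _ = _ := by
            rw [← Real.exp_nat_mul, hy]
            congr 1
            ring
    have h2 : (2 : ℝ) ^ M ≤ Real.exp y := by
      calc (2 : ℝ) ^ M ≤ Real.exp 1 ^ M := by
            refine pow_le_pow_left₀ (by norm_num) ?_ M
            have := Real.add_one_le_exp 1
            linarith
        _ = Real.exp M := by rw [← Real.exp_nat_mul, mul_one]
        _ ≤ _ := Real.exp_le_exp.2 hyM
    have h3 : (2 : ℝ) ^ (M + 1) * (1 - p / 2) ^ N ≤ 2 * Real.exp (-y) := by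
      calc (2 : ℝ) ^ (M + 1) * (1 - p / 2) ^ N
          = 2 * (2 ^ M * (1 - p / 2) ^ N) := by ring
        _ ≤ 2 * (Real.exp y * Real.exp (-(2 * y))) := by gcongr
        _ = _ := by
            rw [← Real.exp_add]
            congr 2
            ring
    have h4 : Real.exp (-y) * y ^ 2 ≤ 2 := by
      have := Real.quadratic_le_exp_of_nonneg hy0.le
      rw [Real.exp_neg, inv_mul_le_iff₀ (Real.exp_pos y)]
      nlinarith
    have h5 : (4 * M / p) ^ 2 * y ^ 2 = (N * M) ^ 2 := by
      rw [hy]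
      field_simp
    have h6 : (N : ℝ) * min 1 (2 ^ (M + 1) * (1 - p / 2) ^ N) * N ≤
        N ^ 2 * (2 * Real.exp (-y)) := by
      have := (min_le_right 1 ((2 : ℝ) ^ (M + 1) * (1 - p / 2) ^ N)).trans h3
      nlinarith [sq_nonneg (N : ℝ)]
    refine h6.trans (le_of_mul_le_mul_right ?_ (pow_pos hy0 2))
    calc (N : ℝ) ^ 2 * (2 * Real.exp (-y)) * y ^ 2
        = 2 * (N : ℝ) ^ 2 * (Real.exp (-y) * y ^ 2) := by ring
      _ ≤ 2 * (N : ℝ) ^ 2 * 2 := by gcongr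
      _ ≤ 4 * ((N : ℝ) * M) ^ 2 := by
          rw [mul_pow]
          have : (1 : ℝ) ≤ (M : ℝ) ^ 2 := one_le_pow₀ hM'
          nlinarith [sq_nonneg (N : ℝ)]
      _ = _ := by rw [← h5]; ring

end ASM

/-! ### The expected running time of TRIM-B. -/

namespace ASM
variable {V : Type} [DecidableEq V]

open RandCost

theorem mean_listSize_le (G : ProbGraph V) (Vi : Finset V) (ηi N : ℕ) (hη : 1 ≤ ηi)
    (hηV : ηi ≤ Vi.card) :
    ((mrrSets G Vi ηi N).mean fun F => (listSize F : ℝ≥0∞)) ≤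
      N * (2 * (mrrSet G Vi ηi).expectedCost) := by
  have h1 : (mrrSet G Vi ηi).mean (fun R => ((R.card + 1 : ℕ) : ℝ≥0∞)) ≤
      2 * (mrrSet G Vi ηi).expectedCost := by
    rw [expectedCost_eq_expect, ← expect_const_mul]
    refine expect_mono_of_post (post_mrrSet G Vi ηi hη hηV) ?_
    rintro R k ⟨-, hR, hk, -⟩
    have := hR.card_pos
    change ((R.card + 1 : ℕ) : ℝ≥0∞) ≤ 2 * (k : ℝ≥0∞)
    exact_mod_cast (by omega : R.card + 1 ≤ 2 * k)
  refine Eq.trans_le ?_ (mul_le_mul_right h1 _)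
  rw [← mean_mrrSets_sum]
  congr 1
  funext F
  simp [listSize, Nat.cast_list_sum, Function.comp_def]

theorem one_le_expectedCost_mrrSet (G : ProbGraph V) (Vi : Finset V) (ηi : ℕ) (hη : 1 ≤ ηi)
    (hηV : ηi ≤ Vi.card) : 1 ≤ (mrrSet G Vi ηi).expectedCost := by
  refine ((mrrSet G Vi ηi).expect_const 1).symm.trans_le
    (expect_mono_of_post (post_mrrSet G Vi ηi hη hηV) ?_)
  rintro R k ⟨-, hR, hk, -⟩
  exact_mod_cast hR.card_pos.trans_le hk

/-- The expected number of steps for doubling `N` mRR-sets and for the iteration that follows, as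
far as `O` intersects fewer than `M` of the `N` sets. -/
theorem mean_doubling_le (G : ProbGraph V) (Vi : Finset V) (ηi b : ℕ) (hη : 1 ≤ ηi)
    (hηV : ηi ≤ Vi.card) (O : Finset V) (hp : 0 < hitProb G Vi ηi O) {M N : ℕ} (hM : 1 ≤ M)
    (hN : 1 ≤ N) :
    ((mrrSets G Vi ηi N).mean fun F => if coverCount F O < M then
        N * (mrrSet G Vi ηi).expectedCost + (mrrSets G Vi ηi N).mean fun F' =>
          ((iterCost Vi b + 4 * listSize (F ++ F') : ℕ) : ℝ≥0∞)
      else 0) ≤ iterCost Vi b + 68 * (mrrSet G Vi ηi).expectedCost *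
        ENNReal.ofReal (min (N : ℝ) ((4 * M / (hitProb G Vi ηi O).toReal) ^ 2 / N)) := by
  set E := (mrrSet G Vi ηi).expectedCost with hE
  set p := (hitProb G Vi ηi O).toReal with hpdef
  have hple := hitProb_le_one G Vi ηi O
  have hp0 : 0 < p := ENNReal.toReal_pos hp.ne' (ne_top_of_le_ne_top ENNReal.one_ne_top hple)
  have hp1 : p ≤ 1 := ENNReal.toReal_le_of_le_ofReal zero_le_one (by simpa)
  -- Per old set: `4 * (R.card + 1)` for rereading it, `E` for generating a new set, and `8 * E` for
  -- reading the new one. The mean is at most `17 * E`, and `68 = 17 * 4`.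
  set w : Finset V → ℝ≥0∞ := fun R => 4 * ((R.card + 1 : ℕ) : ℝ≥0∞) + 9 * E with hw
  have hsum (F : List (Finset V)) : (F.map w).sum = 4 * listSize F + 9 * (F.length * E) := by
    induction F with
    | nil => simp [listSize]
    | cons R F ih =>
      rw [List.map_cons, List.sum_cons, ih, listSize_cons, List.length_cons, hw]
      push_cast
      ring
  have hwmean : (mrrSet G Vi ηi).mean w ≤ 17 * E := by
    have h1 := mean_listSize_le G Vi ηi 1 hη hηV
    simp only [mrrSets, mean_bind, mean_pure, listSize, List.map_cons, List.map_nil,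
      List.sum_cons, List.sum_nil, add_zero, Nat.cast_one, one_mul] at h1
    rw [hw, mean_add, mean_const_mul, mean_const]
    calc _ ≤ 4 * (2 * E) + 9 * E := by gcongr
      _ = _ := by ring
  have hpoint : ∀ F : List (Finset V), F.length = N →
      (if coverCount F O < M then N * E + (mrrSets G Vi ηi N).mean fun F' =>
          ((iterCost Vi b + 4 * listSize (F ++ F') : ℕ) : ℝ≥0∞) else 0) ≤
        iterCost Vi b + if coverCount F O < M then (F.map w).sum else 0 := by
    intro F hF
    split_ifs
    · simp only [listSize_append, Nat.cast_add, Nat.cast_mul, mul_add, mean_add, mean_const,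
        mean_const_mul, Nat.cast_ofNat]
      rw [hsum, hF]
      calc _ ≤ N * E + (iterCost Vi b + (4 * listSize F + 4 * (N * (2 * E)))) := by
            gcongr
            exact mean_listSize_le G Vi ηi N hη hηV
        _ = _ := by ring
    · exact zero_le
  refine (mean_mono_of_post (post_mrrSets G Vi ηi N) fun F _ hF => hpoint F hF).trans ?_
  rw [mean_add, mean_const]
  refine add_le_add_right ((mean_sum_of_coverCount_lt_le G Vi ηi N M O w).trans ?_) _
  rw [mean_hitWeight]
  have hreal : (N : ℝ≥0∞) * min 1 (2 ^ (M + 1) * ENNReal.ofReal (1 - p / 2) ^ N) =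
      ENNReal.ofReal (N * min 1 (2 ^ (M + 1) * (1 - p / 2) ^ N)) := by
    have h0 : 0 ≤ 1 - p / 2 := by linarith
    rw [ENNReal.ofReal_mul (Nat.cast_nonneg _), ENNReal.ofReal_natCast, ENNReal.ofReal_min,
      ENNReal.ofReal_one, ENNReal.ofReal_mul (by positivity), ENNReal.ofReal_pow h0,
      ENNReal.ofReal_pow (by norm_num), ENNReal.ofReal_ofNat]
  rw [hreal]
  calc _ ≤ 17 * E * ENNReal.ofReal (4 * min (N : ℝ) ((4 * M / p) ^ 2 / N)) := by
        exact mul_le_mul' hwmean (ENNReal.ofReal_le_ofReal (two_pow_mul_pow_le hp0 hp1 hM hN))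
    _ = _ := by
        rw [ENNReal.ofReal_mul (by norm_num), ENNReal.ofReal_ofNat]
        ring

/-- Induction on the remaining iterations: the doubling potential at `N` pays for the present
doubling and leaves the potential at `2 * N` for the later ones. -/
theorem mean_continuation_le (G : ProbGraph V) (Vi : Finset V) (ηi b : ℕ) (ε : ℝ) (hη : 1 ≤ ηi)
    (hηV : ηi ≤ Vi.card) (hb : 1 ≤ b) (hbV : b ≤ Vi.card) (O : Finset V) (hO : O ⊆ Vi)
    (hOb : O.card ≤ b) (hp : 0 < hitProb G Vi ηi O) (M : ℕ) (hM1 : 1 ≤ M)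
    (hM : ∀ Λ : ℝ, (M : ℝ) / 2 ≤ Λ → rho b * (1 - epsHat ε) ≤
      coverLower (aOne ε Vi.card ηi b) Λ / coverUpper (aTwo ε Vi.card ηi b) (rho b) Λ)
    (k N : ℕ) (hN : 1 ≤ N) :
    ((mrrSets G Vi ηi N).mean fun F => if coverCount F O < M then
        F.length * (mrrSet G Vi ηi).expectedCost + (mrrSets G Vi ηi F.length).mean fun F' =>
          (trimBLoop G Vi ηi b ε k (F ++ F')).expectedCost
      else 0) ≤ (k + 1) * iterCost Vi b + 68 * (mrrSet G Vi ηi).expectedCost *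
        ENNReal.ofReal (doublingPotential (4 * M / (hitProb G Vi ηi O).toReal) N) := by
  set E := (mrrSet G Vi ηi).expectedCost with hE
  set m : ℝ := 4 * M / (hitProb G Vi ηi O).toReal with hm
  have hp0 : 0 < (hitProb G Vi ηi O).toReal :=
    ENNReal.toReal_pos hp.ne' (ne_top_of_le_ne_top ENNReal.one_ne_top (hitProb_le_one G Vi ηi O))
  have hm0 : 0 < m := by
    have : (0 : ℝ) < M := by exact_mod_cast hM1
    positivity
  induction k generalizing N with
  | zero =>
    have hN0 : (0 : ℝ) < N := by exact_mod_cast hN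
    refine (mean_mono_of_post (post_mrrSets G Vi ηi N) ?_).trans
      ((mean_doubling_le G Vi ηi b hη hηV O hp hM1 hN).trans ?_)
    · rintro F _ rfl
      split_ifs
      · exact add_le_add_right (mean_mono _ fun F' =>
          expectedCost_trimBLoop_zero G Vi ηi b ε hb hbV _) _
      · exact le_rfl
    · rw [Nat.cast_zero, zero_add, one_mul]
      gcongr
      have h1 := min_add_doublingPotential_le hm0 hN0
      have h2 := doublingPotential_nonneg hm0 (x := 2 * N) (by positivity)
      linarith
  | succ k ih =>
    have hN0 : (0 : ℝ) < N := by exact_mod_cast hN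
    set B : List (Finset V) → ℝ≥0∞ := fun F => if coverCount F O < M then
        F.length * E + (mrrSets G Vi ηi F.length).mean fun F' =>
          (trimBLoop G Vi ηi b ε k (F ++ F')).expectedCost
      else 0 with hB
    have hstep : ∀ F : List (Finset V), F.length = N →
        (if coverCount F O < M then
          F.length * E + (mrrSets G Vi ηi F.length).mean fun F' =>
            (trimBLoop G Vi ηi b ε (k + 1) (F ++ F')).expectedCost
        else 0) ≤ (if coverCount F O < M then
          N * E + (mrrSets G Vi ηi N).mean fun F' =>
            ((iterCost Vi b + 4 * listSize (F ++ F') : ℕ) : ℝ≥0∞) else 0) +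
          (mrrSets G Vi ηi N).mean fun F' => B (F ++ F') := by
      rintro F rfl
      split_ifs
      · rw [add_assoc, ← mean_add]
        exact add_le_add_right (mean_mono _ fun F' =>
          expectedCost_trimBLoop_succ G Vi ηi b ε hb hbV O hO hOb M hM k _) _
      · exact zero_le
    refine (mean_mono_of_post (post_mrrSets G Vi ηi N) fun F _ hF => hstep F hF).trans ?_
    -- In `hstep` the later cost was freed of the condition on `F`, so `F ++ F'` is an unconditioned
    -- sample of size `N + N`.
    rw [mean_add, ← mean_mrrSets_add]
    refine (add_le_add (mean_doubling_le G Vi ηi b hη hηV O hp hM1 hN)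
      (ih (N + N) (by omega))).trans ?_
    have h1 := min_add_doublingPotential_le hm0 hN0
    have h2 := doublingPotential_nonneg hm0 (x := 2 * N) (by positivity)
    have hcast : ((N + N : ℕ) : ℝ) = 2 * N := by
      push_cast
      ring
    rw [hcast]
    calc _ = ((k + 1 : ℕ) + 1) * (iterCost Vi b : ℝ≥0∞) + 68 * E *
          (ENNReal.ofReal (min (N : ℝ) (m ^ 2 / N)) +
            ENNReal.ofReal (doublingPotential m (2 * N))) := by
          push_cast
          ring
      _ ≤ _ := by
          rw [← ENNReal.ofReal_add (by positivity) h2]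
          gcongr

/-- A set `O` with the largest hitting probability works: any node extends to a set of `b` nodes,
which is hit whenever the node is in the mRR-set. -/
theorem exists_max_hitProb (G : ProbGraph V) (Vi : Finset V) (ηi b : ℕ) (hb : 1 ≤ b)
    (hbV : b ≤ Vi.card) (hη : 1 ≤ ηi) (hηV : ηi ≤ Vi.card) :
    ∃ O ⊆ Vi, O.card = b ∧ (mrrSet G Vi ηi).expectedCost ≤
      hitProb G Vi ηi O * (5 * Vi.card + 2 * G.edgeCount Vi : ℕ) := by
  obtain ⟨O, hO, hmax⟩ := (Vi.powersetCard b).exists_max_image (hitProb G Vi ηi)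
    (Finset.powersetCard_nonempty.2 hbV)
  rw [Finset.mem_powersetCard] at hO
  refine ⟨O, hO.1, hO.2, mean_mrrSet_le G Vi ηi hη hηV _ fun v hv => ?_⟩
  obtain ⟨S, hvS, hSV, hSb⟩ := Finset.exists_subsuperset_card_eq
    (Finset.singleton_subset_iff.2 hv) (by simpa using hb) hbV
  refine le_trans (mean_mono _ fun R => ?_) (hmax S (Finset.mem_powersetCard.2 ⟨hSV, hSb⟩))
  have hvS' : v ∈ S := hvS (Finset.mem_singleton_self v)
  by_cases hR : v ∈ R
  · rw [if_pos hR, if_pos ⟨v, Finset.mem_inter.2 ⟨hR, hvS'⟩⟩]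
  · rw [if_neg hR]
    exact zero_le

/-- The expected running time of TRIM-B, when `M / 2` covered sets suffice for stopping. -/
theorem expectedCost_trimB_le (G : ProbGraph V) (Vi : Finset V) (ηi b : ℕ) (ε : ℝ) (hη : 1 ≤ ηi)
    (hηV : ηi ≤ Vi.card) (hb : 1 ≤ b) (hbV : b ≤ Vi.card) (M : ℕ) (hM1 : 1 ≤ M)
    (hM : 2 ≤ maxIter ε Vi.card ηi b → ∀ Λ : ℝ, (M : ℝ) / 2 ≤ Λ → rho b * (1 - epsHat ε) ≤
      coverLower (aOne ε Vi.card ηi b) Λ / coverUpper (aTwo ε Vi.card ηi b) (rho b) Λ)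
    (hθ : 2 ≤ maxIter ε Vi.card ηi b → 0 < thetaInit ε Vi.card ηi b) :
    (trimB G Vi ηi b ε).expectedCost ≤
      ((Vi.card + b + 1) + maxIter ε Vi.card ηi b * iterCost Vi b +
        (9 * ⌈thetaInit ε Vi.card ηi b⌉₊ + 1088 * M) * (5 * Vi.card + 2 * G.edgeCount Vi) : ℕ) := by
  obtain ⟨O, hO, hOb, hE⟩ := exists_max_hitProb G Vi ηi b hb hbV hη hηV
  set E := (mrrSet G Vi ηi).expectedCost with hEdef
  set W := 5 * Vi.card + 2 * G.edgeCount Vi with hW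
  set N := ⌈thetaInit ε Vi.card ηi b⌉₊ with hN
  have hple := hitProb_le_one G Vi ηi O
  have hp : 0 < hitProb G Vi ηi O := by
    rw [pos_iff_ne_zero]
    intro h0
    have := (one_le_expectedCost_mrrSet G Vi ηi hη hηV).trans hE
    simp [h0] at this
  have hpfin := ne_top_of_le_ne_top ENNReal.one_ne_top hple
  have hp0 : 0 < (hitProb G Vi ηi O).toReal := ENNReal.toReal_pos hp.ne' hpfin
  have hEW : E ≤ W := hE.trans (mul_le_of_le_one_left' hple)
  have hiter : ((mrrSets G Vi ηi N).mean fun F =>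
      ((iterCost Vi b + 4 * listSize F : ℕ) : ℝ≥0∞)) ≤ iterCost Vi b + 8 * (N * E) := by
    simp only [Nat.cast_add, Nat.cast_mul, mean_add, mean_const, mean_const_mul, Nat.cast_ofNat]
    calc _ ≤ (iterCost Vi b : ℝ≥0∞) + 4 * (N * (2 * E)) := by
          gcongr
          exact mean_listSize_le G Vi ηi N hη hηV
      _ = _ := by ring
  have hloop : ((mrrSets G Vi ηi N).mean fun F =>
      (trimBLoop G Vi ηi b ε (maxIter ε Vi.card ηi b - 1) F).expectedCost) ≤
      maxIter ε Vi.card ηi b * iterCost Vi b + 8 * (N * E) + 1088 * (M * W) := by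
    obtain hT | ⟨k, hT⟩ : maxIter ε Vi.card ηi b = 1 ∨ ∃ k, maxIter ε Vi.card ηi b = k + 2 := by
      have : 1 ≤ maxIter ε Vi.card ηi b := Nat.le_add_left 1 _
      rcases Nat.lt_or_ge (maxIter ε Vi.card ηi b) 2 with h | h
      · exact Or.inl (by omega)
      · exact Or.inr ⟨_, (Nat.sub_add_cancel h).symm⟩
    · rw [hT]
      refine (mean_mono _ fun F => expectedCost_trimBLoop_zero G Vi ηi b ε hb hbV F).trans
        (hiter.trans ?_)
      rw [Nat.cast_one, one_mul]
      exact le_self_add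
    · have hT2 : 2 ≤ maxIter ε Vi.card ηi b := by omega
      have hN1 : 1 ≤ N := Nat.one_le_ceil_iff.2 (hθ hT2)
      have hcont := mean_continuation_le G Vi ηi b ε hη hηV hb hbV O hO hOb.le hp M hM1 (hM hT2) k
        N hN1
      -- The hitting probability in `E ≤ p * W` cancels the one in the potential `16 * M / p`; the
      -- constant is `1088 = 68 * 16`.
      have hpot : 68 * E * ENNReal.ofReal
          (doublingPotential (4 * M / (hitProb G Vi ηi O).toReal) N) ≤ 1088 * (M * W) := by
        have h1 : doublingPotential (4 * M / (hitProb G Vi ηi O).toReal) N ≤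
            16 * M * (hitProb G Vi ηi O).toReal⁻¹ := by
          have hM0 : (0 : ℝ) < M := by exact_mod_cast hM1
          have hN0 : (0 : ℝ) < N := by exact_mod_cast hN1
          refine (doublingPotential_le (by positivity) hN0).trans_eq ?_
          ring
        calc _ ≤ 68 * (hitProb G Vi ηi O * W) *
              ENNReal.ofReal (16 * M * (hitProb G Vi ηi O).toReal⁻¹) := by gcongr
          _ = 68 * (hitProb G Vi ηi O * W) * (16 * M * (hitProb G Vi ηi O)⁻¹) := by
              rw [ENNReal.ofReal_mul (by positivity), ENNReal.ofReal_mul (by norm_num),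
                ENNReal.ofReal_inv_of_pos hp0, ENNReal.ofReal_toReal hpfin, ENNReal.ofReal_natCast,
                ENNReal.ofReal_ofNat]
          _ = 1088 * (M * W) * (hitProb G Vi ηi O * (hitProb G Vi ηi O)⁻¹) := by ring
          _ = _ := by rw [ENNReal.mul_inv_cancel hp.ne' hpfin, mul_one]
      rw [hT, show k + 2 - 1 = k + 1 by omega]
      refine (mean_mono _ fun F => expectedCost_trimBLoop_succ G Vi ηi b ε hb hbV O hO hOb.le M
        (hM hT2) k F).trans ?_
      rw [mean_add]
      calc _ ≤ (iterCost Vi b + 8 * (N * E)) + ((k + 1) * iterCost Vi b + 1088 * (M * W)) :=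
            add_le_add hiter (hcont.trans (add_le_add_right hpot _))
        _ = _ := by
            push_cast
            ring
  rw [trimB, expectedCost_tick_bind, expectedCost_bind, expectedCost_mrrSets]
  calc _ ≤ ((Vi.card + b + 1 : ℕ) : ℝ≥0∞) + (N * E +
        (maxIter ε Vi.card ηi b * iterCost Vi b + 8 * (N * E) + 1088 * (M * W))) := by gcongr
    _ = ((Vi.card + b + 1 : ℕ) : ℝ≥0∞) +
        (maxIter ε Vi.card ηi b * iterCost Vi b + 9 * (N * E) + 1088 * (M * W)) := by ring
    _ ≤ ((Vi.card + b + 1 : ℕ) : ℝ≥0∞) +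
        (maxIter ε Vi.card ηi b * iterCost Vi b + 9 * (N * W) + 1088 * (M * W)) := by gcongr
    _ = _ := by
        push_cast
        ring

theorem post_trimBLoop (G : ProbGraph V) (Vi : Finset V) (ηi b : ℕ) (ε : ℝ) (hb : 1 ≤ b)
    (hbV : b ≤ Vi.card) (k : ℕ) (F : List (Finset V)) :
    (trimBLoop G Vi ηi b ε k F).Post fun S _ => S ⊆ Vi ∧ S.card = b := by
  induction k generalizing F with
  | zero => exact (post_greedy Vi F b hb hbV).mono fun S _ h => ⟨h.1, h.2.1⟩
  | succ k ih =>
    refine (post_greedy Vi F b hb hbV).bind fun S _ hS => ?_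
    refine (post_coverage F S).bind fun Λ _ _ => post_tick_bind ?_
    split_ifs
    · exact post_pure ⟨hS.1, hS.2.1⟩
    · exact (post_mrrSets G Vi ηi F.length).bind fun F' _ _ => ih _

theorem post_trimB (G : ProbGraph V) (Vi : Finset V) (ηi b : ℕ) (ε : ℝ) (hb : 1 ≤ b)
    (hbV : b ≤ Vi.card) : (trimB G Vi ηi b ε).Post fun S _ => S ⊆ Vi ∧ S.card = b :=
  post_tick_bind ((post_mrrSets G Vi ηi _).bind fun _ _ _ =>
    post_trimBLoop G Vi ηi b ε hb hbV _ _)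

end ASM

/-! ### The rounds of ASTI. -/

namespace ASM
variable {V : Type} [DecidableEq V]

open RandCost

theorem subset_influenced {Vi S : Finset V} (φ : Finset (V × V)) (hS : S ⊆ Vi) :
    S ⊆ influenced Vi φ S := fun s hs => by
  classical exact Finset.mem_filter.2 ⟨hS hs, s, hs, hS hs, Relation.ReflTransGen.refl⟩

theorem sum_realizationProb (G : ProbGraph V) :
    ∑ φ ∈ G.edges.powerset, ENNReal.ofReal (G.realizationProb φ) = 1 := by
  rw [← ENNReal.ofReal_sum_of_nonneg]
  · unfold ProbGraph.realizationProb
    rw [← Finset.prod_add]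
    simp
  · intro φ hφ
    rw [Finset.mem_powerset] at hφ
    refine mul_nonneg (Finset.prod_nonneg fun e he => (G.prob_pos e (hφ he)).le)
      (Finset.prod_nonneg fun e he => sub_nonneg.2 (G.prob_le_one e (Finset.mem_sdiff.1 he).1))

variable [Fintype V]

/-- The bound `N` is kept apart from `Vi.card`: for the total time it is the number of all nodes,
since `ε ≥ n ^ (-c)` says nothing of the kind for small residual graphs; for a single round it is
`Vi.card`. -/
theorem expectedCost_astiRound_le {c N : ℕ} (G : ProbGraph V) (η b : ℕ) (ε : ℝ)
    (φ : Finset (V × V)) (Vi : Finset V)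
    (h : ParamRange c N Vi.card (η - (Fintype.card V - Vi.card)) (min b Vi.card) ε) :
    (astiRound G η b ε φ Vi).expectedCost ≤
      ENNReal.ofReal (10 ^ 8 * (c + 1) *
        ((min b Vi.card : ℕ) * Real.log N / ε ^ 2 * (G.edgeCount Vi + Vi.card))) := by
  set β : ℕ := min b Vi.card with hβ
  set ηi := η - (Fintype.card V - Vi.card) with hηi
  set n := Vi.card with hn
  set m := G.edgeCount Vi with hm
  set L := Real.log N with hLdef
  -- Twice the threshold of `stop_of_le`, because greedy is only guaranteed `M / 2`.
  set M : ℕ := ⌈648 * ((5 * c + 22) * (β * L)) / ε ^ 2⌉₊ with hMdef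
  have hε := h.eps_pos
  have hL := h.half_le_log
  have hb := h.one_le_cast_b
  have hbn : (β : ℝ) ≤ n := by exact_mod_cast h.b_le
  have hMle : 648 * ((5 * c + 22) * (β * L)) / ε ^ 2 ≤ M := Nat.le_ceil _
  have hM1 : 1 ≤ M := Nat.one_le_ceil_iff.2 (by positivity)
  have htrim := expectedCost_trimB_le G Vi ηi β ε h.one_le_eta h.eta_le h.one_le_b h.b_le M hM1
    (fun hT Λ hΛ => h.stop_of_le hT (le_trans (by
      calc 324 * ((5 * c + 22) * (β * L)) / ε ^ 2
          = 648 * ((5 * c + 22) * (β * L)) / ε ^ 2 / 2 := by ring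
        _ ≤ (M : ℝ) / 2 := by linarith) hΛ)) h.thetaInit_pos
  have hround : (astiRound G η b ε φ Vi).expectedCost =
      (trimB G Vi ηi β ε).expectedCost + (n + m + 1 : ℕ) := by
    rw [astiRound, expectedCost_bind]
    simp only [expectedCost_tick_bind, expectedCost_pure, mean_const, add_zero]
    rfl
  rw [hround]
  refine (add_le_add_left htrim _).trans ?_
  rw [← Nat.cast_add, ← ENNReal.ofReal_natCast]
  refine ENNReal.ofReal_le_ofReal ?_
  set T := maxIter ε n ηi β with hT
  set N₀ := ⌈thetaInit ε n ηi β⌉₊ with hN₀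
  set B : ℝ := β * L / ε ^ 2 with hB
  have hBL : β * L ≤ B := by
    rw [hB, le_div_iff₀ (by positivity)]
    have : ε ^ 2 ≤ 1 := pow_le_one₀ hε.le h.eps_lt.le
    have : 0 ≤ β * L := by positivity
    nlinarith
  have hB2 : 1 / 2 ≤ B := le_trans (by nlinarith) hBL
  have hcB : 0 ≤ (c : ℝ) * B := by positivity
  have hTle : (T : ℝ) ≤ (4 * c + 10) * L := h.maxIter_le
  have hN₀le : (N₀ : ℝ) ≤ (12 * c + 142) * B := by
    have h1 : thetaInit ε n ηi β ≤ (12 * c + 140) * B :=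
      h.thetaInit_le.trans (by gcongr)
    have h2 := (Nat.ceil_lt_add_one (a := (12 * c + 140) * B) (by positivity)).le
    have h3 : (N₀ : ℝ) ≤ ⌈(12 * c + 140) * B⌉₊ := Nat.cast_le.2 (Nat.ceil_mono h1)
    linarith
  have hMB : (M : ℝ) ≤ 648 * (5 * c + 23) * B := by
    have h1 : 648 * ((5 * c + 22) * (β * L)) / ε ^ 2 = 648 * (5 * c + 22) * B := by
      rw [hB]
      ring
    have h2 := (Nat.ceil_lt_add_one (a := 648 * (5 * c + 22) * B) (by positivity)).le
    rw [hMdef, h1]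
    linarith
  have hm0 : (0 : ℝ) ≤ m := Nat.cast_nonneg m
  set P : ℝ := m + n with hP
  have hP1 : 1 ≤ P := by linarith
  have hPB : P ≤ 2 * (B * P) := by nlinarith
  have hiter : (T : ℝ) * iterCost Vi β ≤ 4 * (4 * c + 10) * (B * P) := by
    have h1 : (iterCost Vi β : ℝ) ≤ 4 * (β * P) := by
      rw [iterCost, ← hn]
      push_cast
      nlinarith
    calc (T : ℝ) * iterCost Vi β ≤ ((4 * c + 10) * L) * (4 * (β * P)) := by gcongr
      _ = 4 * (4 * c + 10) * (β * L * P) := by ring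
      _ ≤ _ := by gcongr
  have hsets : (9 * (N₀ : ℝ) + 1088 * M) * (5 * n + 2 * m) ≤
      5 * (9 * (12 * c + 142) + 1088 * (648 * (5 * c + 23))) * (B * P) := by
    calc (9 * (N₀ : ℝ) + 1088 * M) * (5 * n + 2 * m)
        ≤ (9 * ((12 * c + 142) * B) + 1088 * (648 * (5 * c + 23) * B)) * (5 * P) := by
          gcongr
          linarith
      _ = _ := by ring
  have hcBP : 0 ≤ (c : ℝ) * (B * P) := by positivity
  have hBP : 0 ≤ B * P := by positivity
  -- The dominant constant is `5 * 1088 * 648 * 23`, about `8.1 * 10 ^ 7`; the remaining terms fit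
  -- below `10 ^ 8`.
  push_cast
  linarith

theorem post_astiRound (G : ProbGraph V) (η b : ℕ) (ε : ℝ) (φ : Finset (V × V)) (Vi : Finset V)
    (hb : 1 ≤ b) (hVi : 1 ≤ Vi.card) :
    (astiRound G η b ε φ Vi).Post fun r _ => r.2.card + min b Vi.card ≤ Vi.card := by
  refine (post_trimB G Vi _ _ ε (le_min hb hVi) (min_le_right _ _)).bind ?_
  rintro S _ ⟨hS, hSb⟩
  refine post_tick_bind (post_pure ?_)
  have h1 : Vi \ influenced Vi φ S ⊆ Vi \ S :=
    Finset.sdiff_subset_sdiff subset_rfl (subset_influenced φ hS)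
  have h2 := Finset.card_le_card h1
  have h3 := Finset.card_sdiff_add_card_eq_card hS
  simp only
  omega

/-- If fewer than `b` nodes are left, the round activates all of them, and `η ≤ n` finishes. -/
theorem eta_le_after_round {n η b j a a' : ℕ} (ha : a ≤ n) (hη : η ≤ n) (ha' : a' + min b a ≤ a)
    (hj : η ≤ n - a + (j + 1) * b) : η ≤ n - a' + j * b := by
  rw [Nat.succ_mul] at hj
  omega

/-- Here `j` bounds the number of rounds still needed. As `D` bounds a round from every residual
set, the dependence of that set on earlier random choices is harmless. -/
theorem expectedCost_astiLoop_le (G : ProbGraph V) (η b : ℕ) (ε : ℝ) (φ : Finset (V × V))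
    (hb : 1 ≤ b) (hη : η ≤ Fintype.card V) (D : ℝ≥0∞)
    (hD : ∀ Vi : Finset V, Fintype.card V - Vi.card < η →
      (astiRound G η b ε φ Vi).expectedCost ≤ D)
    (fuel j : ℕ) (st : AstiResult V) (hj : η ≤ Fintype.card V - st.inactive.card + j * b) :
    (astiLoop G η b ε φ fuel st).expectedCost ≤ j * D := by
  induction fuel generalizing j st with
  | zero => exact (expectedCost_pure st).trans_le zero_le
  | succ fuel ih =>
    rw [astiLoop]
    split_ifs with h
    · exact (expectedCost_pure st).trans_le zero_le
    · obtain _ | j := j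
      · omega
      · rw [expectedCost_bind, Nat.cast_succ, add_mul, one_mul, add_comm]
        refine add_le_add (mean_le_of_post (post_astiRound G η b ε φ st.inactive hb (by omega)) ?_)
          (hD _ (by omega))
        intro r _ hr
        exact ih j _ (eta_le_after_round (Finset.card_le_univ _) hη hr hj)

theorem post_astiLoop (G : ProbGraph V) (η b : ℕ) (ε : ℝ) (φ : Finset (V × V))
    (hb : 1 ≤ b) (hη : η ≤ Fintype.card V) (fuel j : ℕ) (st : AstiResult V)
    (hj : η ≤ Fintype.card V - st.inactive.card + j * b) (hfuel : j ≤ fuel) :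
    (astiLoop G η b ε φ fuel st).Post fun r _ =>
      η ≤ Fintype.card V - r.inactive.card ∧ r.rounds ≤ st.rounds + j := by
  induction fuel generalizing j st with
  | zero =>
    obtain rfl : j = 0 := by omega
    exact post_pure ⟨by simpa using hj, le_rfl⟩
  | succ fuel ih =>
    rw [astiLoop]
    split_ifs with h
    · exact post_pure ⟨h, Nat.le_add_right _ _⟩
    · obtain _ | j := j
      · omega
      · refine (post_astiRound G η b ε φ st.inactive hb (by omega)).bind fun r _ hr => ?_
        refine (ih j ⟨st.seeds ∪ r.1, r.2, st.rounds + 1⟩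
          (eta_le_after_round (Finset.card_le_univ _) hη hr hj) (by omega)).mono ?_
        rintro r' _ ⟨h1, h2⟩
        refine ⟨h1, h2.trans ?_⟩
        simp only
        omega

end ASM

/-! ### Assembling the bounds. -/

theorem theorem6 (c : ℕ) :
    ∃ C : ℝ, 0 < C ∧
      ∀ (V : Type) [Fintype V] [DecidableEq V] (G : ASM.ProbGraph V) (η b : ℕ) (ε : ℝ),
        2 ≤ Fintype.card V → 1 ≤ b → b ≤ η → η ≤ Fintype.card V →
        0 < ε → ε < 1 → 1 / (Fintype.card V : ℝ) ^ c ≤ ε →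
        -- the expected running time, over the realization and the algorithm's random choices
        ASM.expectedTime G η b ε ≤
          ENNReal.ofReal (C * ((η : ℝ) * (G.edges.card + Fintype.card V) / ε ^ 2 *
            Real.log (Fintype.card V))) ∧
        -- the same bound for every fixed realization
        (∀ φ ⊆ G.edges, (ASM.asti G η b ε φ).expectedCost ≤
          ENNReal.ofReal (C * ((η : ℝ) * (G.edges.card + Fintype.card V) / ε ^ 2 *
            Real.log (Fintype.card V)))) ∧
        -- the expected running time of a round
        (∀ φ ⊆ G.edges, ∀ Vi : Finset V,
          2 ≤ Vi.card → Fintype.card V - Vi.card < η → 1 / (Vi.card : ℝ) ^ c ≤ ε →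
          (ASM.astiRound G η b ε φ Vi).expectedCost ≤
            ENNReal.ofReal (C * ((b : ℝ) * (G.edgeCount Vi + Vi.card) * Real.log Vi.card /
              ε ^ 2))) ∧
        -- the number of rounds until at least `η` nodes are active
        (∀ φ ⊆ G.edges, ∀ r ∈ (ASM.asti G η b ε φ).outcomes,
          η ≤ Fintype.card V - r.1.inactive.card ∧
          r.1.rounds ≤ ⌈(η : ℝ) / b⌉₊) := by
  refine ⟨2 * (10 ^ 8 * (c + 1)), by positivity, ?_⟩
  intro V _ _ G η b ε hn hb hbη hη hε hε1 hεn
  set n := Fintype.card V with hnV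
  set K : ℝ := 10 ^ 8 * (c + 1) with hK
  have hb' : (1 : ℝ) ≤ b := by exact_mod_cast hb
  have hbη' : (b : ℝ) ≤ η := by exact_mod_cast hbη
  set j := ⌈(η : ℝ) / b⌉₊ with hj
  have hjb : η ≤ j * b := by
    have := Nat.le_ceil ((η : ℝ) / b)
    rw [div_le_iff₀ (by linarith)] at this
    exact_mod_cast this
  -- Rounding up costs at most one more batch, and `b ≤ η`; this is the factor `2` in the constant.
  have hjb2 : (j : ℝ) * b ≤ 2 * η := by
    have h1 := (Nat.ceil_lt_add_one (a := (η : ℝ) / b) (by positivity)).le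
    calc (j : ℝ) * b ≤ (η / b + 1) * b := by gcongr
      _ = η + b := by field_simp
      _ ≤ _ := by linarith
  have hjn : j ≤ n := by
    refine le_trans (Nat.ceil_le.2 ?_) hη
    exact div_le_self (by positivity) hb'
  have hL : 0 ≤ Real.log n := Real.log_natCast_nonneg n
  have hcost (φ : Finset (V × V)) : (ASM.asti G η b ε φ).expectedCost ≤
      ENNReal.ofReal (2 * K * ((η : ℝ) * (G.edges.card + n) / ε ^ 2 * Real.log n)) := by
    have hround : ∀ Vi : Finset V, n - Vi.card < η → (ASM.astiRound G η b ε φ Vi).expectedCost ≤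
        ENNReal.ofReal (K * (b * Real.log n / ε ^ 2 * (G.edges.card + n))) := by
      intro Vi hVi
      have hVn : Vi.card ≤ n := Finset.card_le_univ Vi
      refine (ASM.expectedCost_astiRound_le (c := c) (N := n) G η b ε φ Vi
        ⟨hn, hVn, le_min hb (by omega), min_le_right _ _, by omega, by omega, hε, hε1, hεn⟩).trans
        (ENNReal.ofReal_le_ofReal ?_)
      have h1 : G.edgeCount Vi ≤ G.edges.card := Finset.card_filter_le _ _
      have h2 : min b Vi.card ≤ b := min_le_left _ _
      gcongr
    refine (ASM.expectedCost_astiLoop_le G η b ε φ hb hη _ hround n j _ ?_).trans ?_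
    · exact hjb.trans (Nat.le_add_left _ _)
    · rw [← ENNReal.ofReal_natCast, ← ENNReal.ofReal_mul (Nat.cast_nonneg j)]
      refine ENNReal.ofReal_le_ofReal ?_
      calc (j : ℝ) * (K * (b * Real.log n / ε ^ 2 * (G.edges.card + n)))
          = K * (j * b * (Real.log n / ε ^ 2 * (G.edges.card + n))) := by ring
        _ ≤ K * (2 * η * (Real.log n / ε ^ 2 * (G.edges.card + n))) := by gcongr
        _ = _ := by ring
  refine ⟨?_, fun φ _ => hcost φ, fun φ _ Vi hVi hVη hεi => ?_, fun φ _ r hr => ?_⟩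
  · calc ASM.expectedTime G η b ε
        ≤ ∑ φ ∈ G.edges.powerset, ENNReal.ofReal (G.realizationProb φ) *
            ENNReal.ofReal (2 * K * ((η : ℝ) * (G.edges.card + n) / ε ^ 2 * Real.log n)) :=
          Finset.sum_le_sum fun φ _ => mul_le_mul_right (hcost φ) _
      _ = _ := by rw [← Finset.sum_mul, ASM.sum_realizationProb, one_mul]
  · have hVn : Vi.card ≤ n := Finset.card_le_univ Vi
    refine (ASM.expectedCost_astiRound_le (c := c) (N := Vi.card) G η b ε φ Vi
      ⟨hVi, le_rfl, le_min hb (by omega), min_le_right _ _, by omega, by omega, hε, hε1, hεi⟩).trans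
      (ENNReal.ofReal_le_ofReal ?_)
    have hL' : 0 ≤ Real.log Vi.card := Real.log_natCast_nonneg _
    have h2 : min b Vi.card ≤ b := min_le_left _ _
    calc K * ((min b Vi.card : ℕ) * Real.log Vi.card / ε ^ 2 * (G.edgeCount Vi + Vi.card))
        ≤ K * (b * Real.log Vi.card / ε ^ 2 * (G.edgeCount Vi + Vi.card)) := by gcongr
      _ ≤ 2 * (K * (b * Real.log Vi.card / ε ^ 2 * (G.edgeCount Vi + Vi.card))) :=
          le_mul_of_one_le_left (by positivity) one_le_two
      _ = _ := by ring
  · have := ASM.post_astiLoop G η b ε φ hb hη n j ⟨∅, Finset.univ, 0⟩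
      (hjb.trans (Nat.le_add_left _ _)) hjn r hr
    simpa using this
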